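/- Let $\sigma\in(0,1/2)$, let $S_\sigma=\{s\in\mathbf C\mid\sigma\le\Re s\le1-\sigma\}$, and put $$C_\sigma=\max\{1,\tan\pi\sigma\}\,(\sigma^{-1}-1)^{1/4}\exp\Bigl(\tfrac12+\tfrac1{24\sigma(1/2+\sigma)}\Bigr),$$ $$C'_\sigma=\max\{1,\tan\pi\sigma\}\,(\sigma^{-1}-1)^{1/4}\exp\Bigl(\tfrac12+\tfrac1{24(1-\sigma)(3/2-\sigma)}\Bigr).$$ For real $u>1$ put $x=u+\sqrt{u^2-1}$. Write $(y)_n=y(y+1)\cdots(y+n-1)$, and let $P^\mu_\nu$ be the Legendre function of the first kind of degree $\nu$ and order $\mu$, $$P^\mu_\nu(u)=\frac1{\Gamma(1-\mu)}\Bigl(\frac{u+1}{u-1}\Bigr)^{\mu/2}F\Bigl(-\nu,\nu+1;1-\mu;\frac{1-u}2\Bigr)\qquad(u>1),$$ where $F(a,b;c;z)$ denotes the analytic continuation to $\mathbf C\setminus[1,\infty)$ of Gauss's hypergeometric series. (1) For every even integer $m\ge0$, all $s\in S_\sigma$ and all $u>1$, $$\bigl|P^{-m}_{s-1}(u)\bigr|\le|s(1-s)|^{-(2m+1)/4}\,\frac{C_\sigma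 x^{m-\sigma}+C'_\sigma x^{m-1+\sigma}}{\sqrt\pi\,(4(u^2-1))^{m/2}}\sum_{n=0}^\infty\frac{|(\frac12-m)_n|}{n!}x^{-2n},$$ where the series on the right converges. (2) For all $s\in S_\sigma$ and all $u>1$, $$\bigl|P^{-2}_{s-1}(u)\bigr|\le|s(1-s)|^{-5/4}\,\frac{p_\sigma(u)}{u^2-1},\qquad p_\sigma(u)=\frac{C_\sigma x^{2-\sigma}+C'_\sigma x^{1+\sigma}}{4\sqrt\pi}\bigl((1-x^{-2})^{3/2}+3x^{-2}\bigr).$$ -/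

import Mathlib

namespace LegendreBound

/-- Gauss's hypergeometric function `F(a, b; c; z)` on the half-plane `Re z < 1/2`, that is, the
analytic continuation to this half-plane of the hypergeometric series (Mathlib's `₂F₁`, which is
meaningful only for `|z| < 1`), written through Pfaff's transformation
`F(a, b; c; z) = (1 - z)^(-a) F(a, c - b; c; z / (z - 1))`; here `|z / (z - 1)| < 1`. -/
noncomputable def gaussHypergeometric (a b c z : ℂ) : ℂ :=
  (1 - z) ^ (-a) * ₂F₁ a (c - b) c (z / (z - 1))

theorem one_le_radius_ordinaryHypergeometricSeries (a b c : ℂ) :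
    1 ≤ (ordinaryHypergeometricSeries ℂ a b c).radius := by
  by_cases h : ∀ k : ℕ, (k : ℂ) ≠ -a ∧ (k : ℂ) ≠ -b ∧ (k : ℂ) ≠ -c
  · exact (ordinaryHypergeometricSeries_radius_eq_one ℂ a b c h).ge
  · push Not at h
    obtain ⟨k, hk⟩ := h
    have h3 : (k : ℂ) = -a ∨ (k : ℂ) = -b ∨ (k : ℂ) = -c := by tauto
    rcases h3 with h | h | h
    · obtain rfl : a = -(k : ℂ) := by rw [h, neg_neg]
      simp [ordinaryHypergeometric_radius_top_of_neg_nat₁]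
    · obtain rfl : b = -(k : ℂ) := by rw [h, neg_neg]
      simp [ordinaryHypergeometric_radius_top_of_neg_nat₂]
    · obtain rfl : c = -(k : ℂ) := by rw [h, neg_neg]
      simp [ordinaryHypergeometric_radius_top_of_neg_nat₃]

theorem mem_eball_zero_one {w : ℂ} (h : ‖w‖ < 1) : w ∈ Metric.eball (0 : ℂ) 1 := by
  rw [Metric.mem_eball, edist_zero_right, ← ofReal_norm, ENNReal.ofReal_lt_one]
  exact h

theorem norm_div_sub_one_lt_one {z : ℂ} (hz : z.re < 1 / 2) : ‖z / (z - 1)‖ < 1 := by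
  have h1 : z - 1 ≠ 0 := by
    intro h
    have := congrArg Complex.re h
    simp at this
    linarith
  rw [norm_div, div_lt_one (norm_pos_iff.2 h1), ← sq_lt_sq₀ (norm_nonneg _) (norm_nonneg _),
    ← Complex.normSq_eq_norm_sq, ← Complex.normSq_eq_norm_sq, Complex.normSq_apply,
    Complex.normSq_apply]
  simp
  nlinarith

/-- `gaussHypergeometric a b c` is analytic on the half-plane `Re z < 1/2`. -/
theorem analyticOnNhd_gaussHypergeometric (a b c : ℂ) :
    AnalyticOnNhd ℂ (gaussHypergeometric a b c) {z | z.re < 1 / 2} := by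
  intro z hz
  have hz' : z.re < 1 / 2 := hz
  have h1 : z - 1 ≠ 0 := by
    intro h
    have := congrArg Complex.re h
    simp at this
    linarith
  have hrad := one_le_radius_ordinaryHypergeometricSeries a (c - b) c
  have hF : AnalyticAt ℂ (₂F₁ a (c - b) c : ℂ → ℂ) (z / (z - 1)) := by
    refine (FormalMultilinearSeries.hasFPowerSeriesOnBall
      (ordinaryHypergeometricSeries ℂ a (c - b) c)
      (lt_of_lt_of_le one_pos hrad)).analyticAt_of_mem ?_
    refine Metric.eball_subset_eball hrad ?_
    exact mem_eball_zero_one (norm_div_sub_one_lt_one hz')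
  have hc : AnalyticAt ℂ (fun w : ℂ => (1 - w) ^ (-a)) z := by
    refine AnalyticAt.cpow (by fun_prop) (by fun_prop) (Or.inl ?_)
    simp
    linarith
  refine hc.mul (AnalyticAt.fun_comp hF ?_)
  exact analyticAt_id.div (analyticAt_id.sub analyticAt_const) h1

theorem ascPochhammer_succ_eval_left (n : ℕ) (x : ℂ) :
    (ascPochhammer ℂ (n + 1)).eval x = x * (ascPochhammer ℂ n).eval (x + 1) := by
  simp [ascPochhammer_succ_left]

/-- The Chu–Vandermonde identity. -/
theorem sum_choose_mul_ascPochhammer (N : ℕ) : ∀ c d : ℂ,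
    ∑ n ∈ Finset.range (N + 1), (N.choose n : ℂ) * (-1) ^ n * (ascPochhammer ℂ n).eval d *
      (ascPochhammer ℂ (N - n)).eval (c + n) = (ascPochhammer ℂ N).eval (c - d) := by
  induction N with
  | zero => simp
  | succ N ih =>
    intro c d
    have h1 : ∀ n ∈ Finset.range (N + 1), ((N + 1).choose (n + 1) : ℂ) * (-1) ^ (n + 1) *
        (ascPochhammer ℂ (n + 1)).eval d * (ascPochhammer ℂ (N + 1 - (n + 1))).eval
          (c + (n + 1 : ℕ)) =
        -((N.choose n : ℂ) * (-1) ^ n * ((ascPochhammer ℂ n).eval d * (d + n)) *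
          (ascPochhammer ℂ (N - n)).eval (c + 1 + n)) +
        (N.choose (n + 1) : ℂ) * (-1) ^ (n + 1) *
        (ascPochhammer ℂ (n + 1)).eval d * (ascPochhammer ℂ (N + 1 - (n + 1))).eval
          (c + (n + 1 : ℕ)) := by
      intro n _
      rw [Nat.choose_succ_succ, ascPochhammer_succ_eval, Nat.succ_sub_succ,
        show c + ((n + 1 : ℕ) : ℂ) = c + 1 + n by push_cast; ring]
      push_cast
      ring
    rw [Finset.sum_range_succ', Finset.sum_congr rfl h1, Finset.sum_add_distrib, add_assoc]
    have h2 := Finset.sum_range_succ' (fun n => (N.choose n : ℂ) * (-1) ^ n *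
        (ascPochhammer ℂ n).eval d * (ascPochhammer ℂ (N + 1 - n)).eval (c + n)) (N + 1)
    simp only [Nat.choose_zero_right] at h2 ⊢
    rw [← h2, Finset.sum_range_succ _ (N + 1), Nat.choose_succ_self]
    simp only [Nat.cast_zero, zero_mul, add_zero]
    rw [← Finset.sum_add_distrib, ascPochhammer_succ_eval_left,
      show c - d + 1 = (c + 1) - d by ring, ← ih (c + 1) d, Finset.mul_sum]
    refine Finset.sum_congr rfl fun n hn => ?_
    have hn' : n ≤ N := by simpa [Nat.lt_succ_iff] using hn
    rw [Nat.succ_sub hn', ascPochhammer_succ_eval_left,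
      show c + (n : ℂ) + 1 = c + 1 + n by ring]
    ring

theorem hasSum_ascPochhammer_mul_pow (α : ℂ) {z : ℂ} (hz : ‖z‖ < 1) :
    HasSum (fun k : ℕ => (ascPochhammer ℂ k).eval α / (k.factorial : ℂ) * z ^ k)
      ((1 - z) ^ (-α)) := by
  have h := (Complex.one_div_one_sub_cpow_hasFPowerSeriesOnBall_zero α).hasSum
    (y := z) (mem_eball_zero_one hz)
  have e : ∀ k : ℕ, Ring.choose (α + k - 1) k = (ascPochhammer ℂ k).eval α / (k.factorial : ℂ) := by
    intro k
    rw [Ring.choose, show α + k - 1 - k + 1 = α by ring, eq_div_iff (Nat.cast_ne_zero.2 k.factorial_ne_zero)]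
    have := Ring.factorial_nsmul_multichoose_eq_ascPochhammer α k
    rw [Polynomial.ascPochhammer_smeval_eq_eval, nsmul_eq_mul] at this
    rw [← this, mul_comm]
  simp only [FormalMultilinearSeries.ofScalars_apply_eq, e, zero_add, smul_eq_mul, one_div,
    ← Complex.cpow_neg] at h
  exact h

theorem norm_ascPochhammer_eval_le (k : ℕ) {α : ℂ} {r : ℝ} (h : ‖α‖ ≤ r) :
    ‖(ascPochhammer ℂ k).eval α‖ ≤ (ascPochhammer ℝ k).eval r := by
  induction k with
  | zero => simp
  | succ k ih =>
    rw [ascPochhammer_succ_eval, ascPochhammer_succ_eval, norm_mul]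
    have : ‖α + k‖ ≤ r + k := (norm_add_le _ _).trans (by simpa using h)
    exact mul_le_mul ih this (norm_nonneg _) ((norm_nonneg _).trans ih)

theorem hasSum_ascPochhammer_mul_pow_real (α : ℝ) {r : ℝ} (hr0 : 0 ≤ r) (hr : r < 1) :
    HasSum (fun k : ℕ => (ascPochhammer ℝ k).eval α / (k.factorial : ℝ) * r ^ k)
      ((1 - r) ^ (-α)) := by
  rw [← Complex.hasSum_ofReal]
  have h := hasSum_ascPochhammer_mul_pow (α : ℂ) (z := (r : ℂ)) (by simpa [abs_of_nonneg hr0] using hr)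
  have e : ∀ k : ℕ, (ascPochhammer ℂ k).eval (α : ℂ) = (((ascPochhammer ℝ k).eval α : ℝ) : ℂ) := by
    intro k
    induction k with
    | zero => simp
    | succ k ih => rw [ascPochhammer_succ_eval, ascPochhammer_succ_eval, ih]; push_cast; rfl
  convert h using 1
  · ext k
    rw [e]
    push_cast
    rfl
  · rw [Complex.ofReal_cpow (by linarith)]
    push_cast
    rfl

theorem tsum_prod_eq_tsum_sum_antidiagonal {f : ℕ × ℕ → ℂ} (h : Summable f) :
    ∑' p, f p = ∑' N, ∑ p ∈ Finset.HasAntidiagonal.antidiagonal N, f p := by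
  conv_rhs => congr; ext; rw [← Finset.sum_finset_coe, ← tsum_fintype (L := .unconditional _)]
  rw [← Finset.HasAntidiagonal.sigmaAntidiagonalEquivProd.tsum_eq f]
  exact Summable.tsum_sigma' (fun n ↦ (hasSum_fintype _).summable)
    (Finset.HasAntidiagonal.sigmaAntidiagonalEquivProd.summable_iff.2 h)

/-- The terms of the double series obtained by expanding the powers of `1 - z` in
`gaussHypergeometric`. -/
noncomputable def pfaffTerm (a b c z : ℂ) (p : ℕ × ℕ) : ℂ :=
  ordinaryHypergeometricCoefficient a (c - b) c p.1 * (-1) ^ p.1 * z ^ p.1 *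
    ((ascPochhammer ℂ p.2).eval (a + p.1) / (p.2.factorial : ℂ) * z ^ p.2)

theorem sum_antidiagonal_pfaffTerm (a b c z : ℂ) (hc : ∀ k : ℕ, c ≠ -(k : ℂ)) (N : ℕ) :
    ∑ p ∈ Finset.HasAntidiagonal.antidiagonal N, pfaffTerm a b c z p =
      ordinaryHypergeometricCoefficient a b c N * z ^ N := by
  have hP : ∀ n : ℕ, (ascPochhammer ℂ n).eval c ≠ 0 := by
    intro n h
    obtain ⟨k, -, hk⟩ := (ascPochhammer_eval_eq_zero_iff _ _).1 h
    exact hc k (by rw [hk, neg_neg])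
  rw [Finset.Nat.sum_antidiagonal_eq_sum_range_succ_mk]
  have key := sum_choose_mul_ascPochhammer N c (c - b)
  rw [sub_sub_cancel] at key
  rw [ordinaryHypergeometricCoefficient, ← key, Finset.mul_sum, Finset.sum_mul, Finset.sum_mul]
  refine Finset.sum_congr rfl fun n hn => ?_
  have hn' : n ≤ N := by simpa [Nat.lt_succ_iff] using hn
  have split : ∀ x : ℂ, (ascPochhammer ℂ N).eval x =
      (ascPochhammer ℂ n).eval x * (ascPochhammer ℂ (N - n)).eval (x + n) := by
    intro x
    have := congrArg (Polynomial.eval x) (ascPochhammer_mul ℂ n (N - n))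
    simpa [Nat.add_sub_cancel' hn'] using this.symm
  have hNc := hP N
  rw [split c] at hNc
  have hz' : z ^ N = z ^ n * z ^ (N - n) := by rw [← pow_add, Nat.add_sub_cancel' hn']
  have hfac : (N.factorial : ℂ) ≠ 0 := Nat.cast_ne_zero.2 N.factorial_ne_zero
  have hfn : (n.factorial : ℂ) ≠ 0 := Nat.cast_ne_zero.2 n.factorial_ne_zero
  have hfk : ((N - n).factorial : ℂ) ≠ 0 := Nat.cast_ne_zero.2 (N - n).factorial_ne_zero
  have h1 := left_ne_zero_of_mul hNc
  have h2 := right_ne_zero_of_mul hNc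
  simp only [pfaffTerm, ordinaryHypergeometricCoefficient]
  rw [Nat.cast_choose ℂ hn', split a, split c, hz']
  generalize (ascPochhammer ℂ n).eval c = p1 at *
  generalize (ascPochhammer ℂ (N - n)).eval (c + n) = p2 at *
  generalize (ascPochhammer ℂ n).eval a = p3 at *
  generalize (ascPochhammer ℂ (N - n)).eval (a + n) = p4 at *
  generalize (ascPochhammer ℂ n).eval (c - b) = p5 at *
  generalize (N.factorial : ℂ) = p6 at *
  generalize (n.factorial : ℂ) = p7 at *
  generalize ((N - n).factorial : ℂ) = p8 at *
  field_simp

theorem summable_pfaffTerm (a b c : ℂ) {z : ℂ} (hz : ‖z‖ < 1 / 2) :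
    Summable (pfaffTerm a b c z) := by
  have hz1 : ‖z‖ < 1 := by linarith
  have hr0 : 0 ≤ ‖z‖ := norm_nonneg z
  set r := ‖z‖ with hr
  set B : ℕ → ℂ := fun n => ordinaryHypergeometricCoefficient a (c - b) c n with hB
  have hreal : ∀ n : ℕ, HasSum (fun k : ℕ => ‖B n‖ * r ^ n *
      ((ascPochhammer ℝ k).eval (‖a‖ + n) / (k.factorial : ℝ) * r ^ k))
      (‖B n‖ * r ^ n * (1 - r) ^ (-(‖a‖ + n))) := fun n =>
    (hasSum_ascPochhammer_mul_pow_real (‖a‖ + n) hr0 hz1).mul_left _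
  set g : ℕ × ℕ → ℝ := fun p => ‖B p.1‖ * r ^ p.1 *
    ((ascPochhammer ℝ p.2).eval (‖a‖ + p.1) / (p.2.factorial : ℝ) * r ^ p.2) with hg
  have hle : ∀ p, ‖pfaffTerm a b c z p‖ ≤ g p := by
    intro p
    have h : ‖(ascPochhammer ℂ p.2).eval (a + p.1)‖ ≤ (ascPochhammer ℝ p.2).eval (‖a‖ + p.1) :=
      norm_ascPochhammer_eval_le _ ((norm_add_le _ _).trans (by simp))
    have e : ‖pfaffTerm a b c z p‖ = ‖B p.1‖ * r ^ p.1 *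
        (‖(ascPochhammer ℂ p.2).eval (a + p.1)‖ / (p.2.factorial : ℝ) * r ^ p.2) := by
      change ‖B p.1 * (-1) ^ p.1 * z ^ p.1 * _‖ = _
      generalize B p.1 = β
      simp only [norm_mul, norm_div, norm_pow, norm_neg, norm_one, one_pow, mul_one,
        Complex.norm_natCast, hr]
    rw [e]
    simp only [hg]
    gcongr
  refine Summable.of_norm_bounded (g := g) ?_ hle
  refine (summable_prod_of_nonneg fun p => (norm_nonneg _).trans (hle p)).2
    ⟨fun n => (hreal n).summable, ?_⟩
  have hrr : r / (1 - r) < 1 := by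
    rw [div_lt_one (by linarith)]
    linarith
  have hrr0 : 0 ≤ r / (1 - r) := div_nonneg hr0 (by linarith)
  have hs : Summable fun n => ‖B n‖ * (r / (1 - r)) ^ n := by
    have hw : ‖((r / (1 - r) : ℝ) : ℂ)‖ = r / (1 - r) := by
      rw [Complex.norm_real, Real.norm_of_nonneg hrr0]
    have h := FormalMultilinearSeries.summable_norm_apply
      (ordinaryHypergeometricSeries ℂ a (c - b) c) (x := ((r / (1 - r) : ℝ) : ℂ))
      (Metric.eball_subset_eball (one_le_radius_ordinaryHypergeometricSeries a (c - b) c)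
        (mem_eball_zero_one (by rw [hw]; exact hrr)))
    refine h.congr fun n => ?_
    rw [ordinaryHypergeometricSeries_apply_eq, norm_smul, norm_pow, hw]
  refine (hs.mul_left ((1 - r) ^ (-‖a‖))).congr fun n => ?_
  have e := (hreal n).tsum_eq
  simp only [hg]
  rw [e, neg_add, Real.rpow_add (by linarith), Real.rpow_neg (by linarith) (n : ℝ),
    Real.rpow_natCast, div_pow, div_eq_mul_inv]
  ring

/-- Pfaff's transformation: near the origin `gaussHypergeometric` is the sum of the hypergeometric
series. -/
theorem gaussHypergeometric_eq_ordinaryHypergeometric (a b c : ℂ) (hc : ∀ k : ℕ, c ≠ -(k : ℂ))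
    {z : ℂ} (hz : ‖z‖ < 1 / 2) : gaussHypergeometric a b c z = ₂F₁ a b c z := by
  have hz0 : 1 - z ≠ 0 := by
    intro h
    have h1 : z = 1 := by linear_combination -h
    rw [h1, norm_one] at hz
    norm_num at hz
  have hsumm := summable_pfaffTerm a b c hz
  have hin : ∀ n : ℕ, ∑' k, pfaffTerm a b c z (n, k) =
      ordinaryHypergeometricCoefficient a (c - b) c n * (-1) ^ n * z ^ n *
        (1 - z) ^ (-(a + n)) := fun n =>
    ((hasSum_ascPochhammer_mul_pow (a + n) (by linarith)).mul_left
      (ordinaryHypergeometricCoefficient a (c - b) c n * (-1) ^ n * z ^ n)).tsum_eq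
  calc gaussHypergeometric a b c z = ∑' p, pfaffTerm a b c z p := by
        rw [hsumm.tsum_prod, gaussHypergeometric, ordinaryHypergeometric_eq_tsum]
        simp only [smul_eq_mul]
        rw [← tsum_mul_left]
        refine tsum_congr fun n => ?_
        have e : z / (z - 1) = -1 * z * (1 - z)⁻¹ := by
          rw [← neg_sub 1 z, div_neg, div_eq_mul_inv]
          ring
        rw [hin, neg_add, Complex.cpow_add _ _ hz0, Complex.cpow_neg _ (n : ℂ),
          Complex.cpow_natCast, e, mul_pow, mul_pow, inv_pow]
        ring
    _ = ₂F₁ a b c z := by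
        rw [tsum_prod_eq_tsum_sum_antidiagonal hsumm, ordinaryHypergeometric_eq_tsum]
        refine tsum_congr fun N => ?_
        rw [sum_antidiagonal_pfaffTerm a b c z hc, smul_eq_mul]

/-- The Legendre function of the first kind `P^μ_ν(u)` of degree `ν` and order `μ`, for real
`u > 1` and `μ` not a positive integer:
`P^μ_ν(u) = Γ(1 - μ)⁻¹ ((u + 1) / (u - 1))^(μ / 2) F(-ν, ν + 1; 1 - μ; (1 - u) / 2)`. -/
noncomputable def legendreP (μ ν : ℂ) (u : ℝ) : ℂ :=
  (Complex.Gamma (1 - μ))⁻¹ * (((u + 1) / (u - 1) : ℝ) : ℂ) ^ (μ / 2) *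
    gaussHypergeometric (-ν) (ν + 1) (1 - μ) (((1 - u) / 2 : ℝ) : ℂ)

/-- The strip `σ ≤ Re s ≤ 1 - σ`. -/
def strip (σ : ℝ) : Set ℂ := {s | σ ≤ s.re ∧ s.re ≤ 1 - σ}

/-- The constant `C_σ`. -/
noncomputable def boundConst (σ : ℝ) : ℝ :=
  max 1 (Real.tan (Real.pi * σ)) * (σ⁻¹ - 1) ^ (1 / 4 : ℝ) *
    Real.exp (1 / 2 + 1 / (24 * σ * (1 / 2 + σ)))

/-- The constant `C'_σ`. -/
noncomputable def boundConst' (σ : ℝ) : ℝ :=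
  max 1 (Real.tan (Real.pi * σ)) * (σ⁻¹ - 1) ^ (1 / 4 : ℝ) *
    Real.exp (1 / 2 + 1 / (24 * (1 - σ) * (3 / 2 - σ)))

/-- The quantity `x = u + √(u² - 1)`, so that `u = (x + x⁻¹) / 2` for `u ≥ 1`. -/
noncomputable def xOf (u : ℝ) : ℝ := u + √(u ^ 2 - 1)

/-- The elementary function `p_σ` on `[1, ∞)`. -/
noncomputable def pSigma (σ u : ℝ) : ℝ :=
  (boundConst σ * xOf u ^ (2 - σ) + boundConst' σ * xOf u ^ (1 + σ)) / (4 * √Real.pi) *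
    ((1 - xOf u ^ (-2 : ℝ)) ^ (3 / 2 : ℝ) + 3 * xOf u ^ (-2 : ℝ))

end LegendreBound

/-! Put u = cosh ξ, so x = e^ξ. Up to an elementary factor, P^{-m}_{s-1}(cosh ξ) is a regular
solution at ξ = 0 of a second-order equation invariant under s ↦ 1 - s. Near infinity this equation
has solutions behaving like e^{-(m+s)ξ} and e^{-(m+1-s)ξ}, each a hypergeometric series in e^{-2ξ}.
The connection formula (`regSol_cosh_eq`, `legendreP_cosh_eq`) expands the Legendre function in
these two. Its coefficients are quotients of Wronskians, which are constant after multiplication by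
(2 sinh ξ)^{2m+1}: one is read off at infinity, the others at ξ → 0, where an Abelian theorem gives
the size of the singularity.

Euler's transformation puts each term of the expansion into the form Γ(1/2 - s) / Γ(m + 1 - s) ·
e^{(m-s)ξ} F(1/2 - m, s - m; s + 1/2; e^{-2ξ}), or the same with s and 1 - s exchanged. Since Γ(m +
1 - s) = (1-s)_m Γ(1 - s), and |(s-m)_n / (s+1/2)_n| is at most |(1-s)_m| |s(1-s)|^{-m/2} uniformly
in n (`norm_ascPochhammer_mul_pow_le`), the series is majorised by the binomial series with absolute
values. What remains is Γ(1/2 - s) / Γ(1 - s) = tan(πs) Γ(s) / Γ(s + 1/2), estimated through Gauss's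
product for Γ; this yields the missing |s(1-s)|^{-1/4} and the constants.

The prefactors Γ(1/2 - s) and Γ(s - 1/2) have poles at s = 1/2, so the estimate is made only on the
lines Re s = σ and Re s = 1 - σ. The function (s(1-s))^{(2m+1)/4} P^{-m}_{s-1}(u) is holomorphic on
the strip and of exponential growth, and the Phragmén–Lindelöf principle carries the bound inside
(`norm_mul_legendreP_le`). -/

namespace LegendreBound

open Filter Topology Set

/-! ### Power series in the unit disc and the hypergeometric equation -/

/-- The power series with coefficients `d` converges absolutely in the open unit disc. -/
def DiscSummable (d : ℕ → ℂ) : Prop := ∀ r : ℝ, 0 ≤ r → r < 1 → Summable fun n => ‖d n‖ * r ^ n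

/-- The coefficients of the derivative of a power series. -/
def derivCoeff (d : ℕ → ℂ) (n : ℕ) : ℂ := (n + 1) * d (n + 1)

theorem DiscSummable.summable {d : ℕ → ℂ} (hd : DiscSummable d) {z : ℂ} (hz : ‖z‖ < 1) :
    Summable fun n => d n * z ^ n := by
  refine Summable.of_norm ?_
  simpa using hd ‖z‖ (norm_nonneg z) hz

/-- The terms are bounded at a slightly larger radius ρ, so those of the derivative at r are
dominated by a multiple of (n + 1)(r/ρ)^n. -/
theorem DiscSummable.derivCoeff {d : ℕ → ℂ} (hd : DiscSummable d) :
    DiscSummable (derivCoeff d) := by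
  intro r hr0 hr1
  obtain ⟨ρ, hr, hρ⟩ := exists_between hr1
  have hρ0 : 0 < ρ := hr0.trans_lt hr
  obtain ⟨C, hC⟩ : ∃ C, ∀ n, ‖d n‖ * ρ ^ n ≤ C := by
    obtain ⟨C, hC⟩ := (hd ρ hρ0.le hρ).tendsto_atTop_zero.bddAbove_range
    exact ⟨C, fun n => hC ⟨n, rfl⟩⟩
  have hq1 : ‖r / ρ‖ < 1 := by
    rw [Real.norm_of_nonneg (by positivity), div_lt_one hρ0]
    exact hr
  have h2 : Summable fun n : ℕ => ((n : ℝ) ^ 1 * (r / ρ) ^ n + (r / ρ) ^ n) * (C / ρ) :=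
    ((summable_pow_mul_geometric_of_norm_lt_one 1 hq1).add
      (summable_geometric_of_norm_lt_one hq1)).mul_right _
  refine Summable.of_nonneg_of_le (fun n => by positivity) (fun n => ?_) h2
  have e : ‖LegendreBound.derivCoeff d n‖ = (n + 1) * ‖d (n + 1)‖ := by
    rw [LegendreBound.derivCoeff, norm_mul]
    congr 1
    exact_mod_cast Complex.norm_natCast (n + 1)
  rw [e]
  have e2 : ((n : ℝ) ^ 1 * (r / ρ) ^ n + (r / ρ) ^ n) * (C / ρ) =
      (n + 1) * (r / ρ) ^ n / ρ * C := by ring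
  have e3 : (n + 1 : ℝ) * ‖d (n + 1)‖ * r ^ n =
      (n + 1) * (r / ρ) ^ n / ρ * (‖d (n + 1)‖ * ρ ^ (n + 1)) := by
    rw [div_pow]
    field_simp
    ring
  rw [e2, e3]
  exact mul_le_mul_of_nonneg_left (hC _) (by positivity)

theorem DiscSummable.hasDerivAt {d : ℕ → ℂ} (hd : DiscSummable d) {z : ℂ} (hz : ‖z‖ < 1) :
    HasDerivAt (fun z => ∑' n, d n * z ^ n) (∑' n, LegendreBound.derivCoeff d n * z ^ n) z := by
  obtain ⟨r, hr, hr1⟩ := exists_between hz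
  have hr0 : 0 ≤ r := (norm_nonneg z).trans hr.le
  have hs := hd.derivCoeff r hr0 hr1
  have hu : Summable fun n : ℕ => (n : ℝ) * ‖d n‖ * r ^ (n - 1) := by
    rw [← summable_nat_add_iff 1]
    refine hs.congr fun n => ?_
    rw [LegendreBound.derivCoeff, norm_mul]
    simp only [Nat.add_sub_cancel]
    congr 2
    exact_mod_cast Complex.norm_natCast (n + 1)
  have h := hasDerivAt_tsum_of_isPreconnected (g := fun n z => d n * z ^ n)
    (g' := fun n z => d n * (n * z ^ (n - 1))) (t := Metric.ball (0 : ℂ) r) (y₀ := 0) (y := z)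
    hu Metric.isOpen_ball (convex_ball (0 : ℂ) r).isPreconnected
    (fun n y _ => (hasDerivAt_pow n y).const_mul (d n))
    (fun n y hy => by
      have hy' : ‖y‖ ≤ r := by simpa using (mem_ball_zero_iff.1 hy).le
      rw [norm_mul, norm_mul, norm_pow, Complex.norm_natCast]
      calc ‖d n‖ * (n * ‖y‖ ^ (n - 1)) ≤ ‖d n‖ * (n * r ^ (n - 1)) := by gcongr
        _ = _ := by ring)
    (mem_ball_zero_iff.2 (by simpa using (norm_nonneg z).trans_lt hr))
    (hd.summable (by simp)) (mem_ball_zero_iff.2 hr)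
  refine h.congr_deriv ?_
  have hs' : Summable fun n : ℕ => d n * (n * z ^ (n - 1)) := by
    refine Summable.of_norm_bounded hu fun n => ?_
    rw [norm_mul, norm_mul, norm_pow, Complex.norm_natCast]
    calc ‖d n‖ * (n * ‖z‖ ^ (n - 1)) ≤ ‖d n‖ * (n * r ^ (n - 1)) := by gcongr
      _ = _ := by ring
  rw [hs'.tsum_eq_zero_add]
  simp only [Nat.cast_zero, zero_mul, mul_zero, zero_add]
  refine tsum_congr fun n => ?_
  simp only [LegendreBound.derivCoeff, Nat.add_sub_cancel]
  push_cast
  ring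

theorem DiscSummable.hasSum_mul_deriv {d : ℕ → ℂ} (hd : DiscSummable d) {z : ℂ} (hz : ‖z‖ < 1) :
    HasSum (fun n : ℕ => n * d n * z ^ n)
      (z * ∑' n, LegendreBound.derivCoeff d n * z ^ n) := by
  have h := (hd.derivCoeff.summable hz).hasSum.mul_left z
  rw [← hasSum_nat_add_iff' 1]
  simp only [Finset.range_one, Finset.sum_singleton, Nat.cast_zero, zero_mul, sub_zero]
  refine h.congr_fun fun n => ?_
  simp only [LegendreBound.derivCoeff]
  push_cast
  ring

/-- The coefficients of the hypergeometric series. -/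
noncomputable abbrev hypCoeff (a b c : ℂ) (n : ℕ) : ℂ := ordinaryHypergeometricCoefficient a b c n

theorem discSummable_hypCoeff (a b c : ℂ) : DiscSummable (hypCoeff a b c) := by
  intro r hr0 hr1
  have hw : ‖(r : ℂ)‖ = r := by rw [Complex.norm_real, Real.norm_of_nonneg hr0]
  have h := FormalMultilinearSeries.summable_norm_apply
    (ordinaryHypergeometricSeries ℂ a b c) (x := (r : ℂ))
    (Metric.eball_subset_eball (one_le_radius_ordinaryHypergeometricSeries a b c)
      (mem_eball_zero_one (by rw [hw]; exact hr1)))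
  refine h.congr fun n => ?_
  rw [ordinaryHypergeometricSeries_apply_eq, norm_smul, norm_pow, hw]

theorem ordinaryHypergeometric_eq_tsum_hypCoeff (a b c z : ℂ) :
    ₂F₁ a b c z = ∑' n, hypCoeff a b c n * z ^ n := by
  rw [ordinaryHypergeometric_eq_tsum]
  simp only [smul_eq_mul]

theorem ascPochhammer_eval_ne_zero {c : ℂ} (hc : ∀ k : ℕ, c ≠ -(k : ℂ)) (n : ℕ) :
    (ascPochhammer ℂ n).eval c ≠ 0 := by
  intro h
  obtain ⟨k, -, hk⟩ := (ascPochhammer_eval_eq_zero_iff _ _).1 h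
  exact hc k (by rw [hk, neg_neg])

theorem hypCoeff_succ (a b : ℂ) {c : ℂ} (hc : ∀ k : ℕ, c ≠ -(k : ℂ)) (n : ℕ) :
    (n + 1) * (c + n) * hypCoeff a b c (n + 1) = (a + n) * (b + n) * hypCoeff a b c n := by
  have h1 := ascPochhammer_eval_ne_zero hc n
  have h2 : c + n ≠ 0 := fun h => hc n (by linear_combination h)
  have h3 : (n.factorial : ℂ) ≠ 0 := Nat.cast_ne_zero.2 n.factorial_ne_zero
  have h4 : (n + 1 : ℂ) ≠ 0 := by exact_mod_cast n.succ_ne_zero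
  simp only [hypCoeff, ordinaryHypergeometricCoefficient, ascPochhammer_succ_eval, Nat.factorial_succ]
  push_cast
  field_simp

/-- The first derivative of the hypergeometric function. -/
noncomputable def hypDeriv (a b c z : ℂ) : ℂ := ∑' n, derivCoeff (hypCoeff a b c) n * z ^ n

/-- The second derivative of the hypergeometric function. -/
noncomputable def hypDeriv₂ (a b c z : ℂ) : ℂ :=
  ∑' n, derivCoeff (derivCoeff (hypCoeff a b c)) n * z ^ n

theorem hasDerivAt_ordinaryHypergeometric (a b c : ℂ) {z : ℂ} (hz : ‖z‖ < 1) :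
    HasDerivAt (₂F₁ a b c) (hypDeriv a b c z) z := by
  have h := (discSummable_hypCoeff a b c).hasDerivAt hz
  rwa [← funext (ordinaryHypergeometric_eq_tsum_hypCoeff a b c)] at h

theorem hasDerivAt_hypDeriv (a b c : ℂ) {z : ℂ} (hz : ‖z‖ < 1) :
    HasDerivAt (hypDeriv a b c) (hypDeriv₂ a b c z) z :=
  (discSummable_hypCoeff a b c).derivCoeff.hasDerivAt hz

/-- The hypergeometric differential equation. -/
theorem hypergeometric_ode (a b : ℂ) {c : ℂ} (hc : ∀ k : ℕ, c ≠ -(k : ℂ)) {z : ℂ} (hz : ‖z‖ < 1) :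
    z * (1 - z) * hypDeriv₂ a b c z + (c - (a + b + 1) * z) * hypDeriv a b c z -
      a * b * ₂F₁ a b c z = 0 := by
  have hd := discSummable_hypCoeff a b c
  have s0 := (hd.summable hz).hasSum
  have s1 := (hd.derivCoeff.summable hz).hasSum
  have s2 := hd.hasSum_mul_deriv hz
  have s3 := hd.derivCoeff.hasSum_mul_deriv hz
  have s4 : HasSum (fun n : ℕ => n * (n - 1) * hypCoeff a b c n * z ^ n)
      (z * (z * ∑' n, derivCoeff (derivCoeff (hypCoeff a b c)) n * z ^ n)) := by
    rw [← hasSum_nat_add_iff' 1]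
    simp only [Finset.range_one, Finset.sum_singleton, Nat.cast_zero, zero_mul, sub_zero]
    refine (s3.mul_left z).congr_fun fun n => ?_
    simp only [derivCoeff]
    push_cast
    ring
  have h := ((s3.sub s4).add ((s1.mul_left c).sub (s2.mul_left (a + b + 1)))).sub
    (s0.mul_left (a * b))
  -- The coefficient of z^n in the equation vanishes by the recurrence `hypCoeff_succ`.
  have hz' := h.unique (hasSum_zero.congr_fun fun n => ?_)
  · rw [ordinaryHypergeometric_eq_tsum_hypCoeff, hypDeriv₂, hypDeriv, ← hz']
    ring
  · have := hypCoeff_succ a b hc n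
    simp only [derivCoeff]
    linear_combination z ^ n * this

/-! ### Behaviour of hypergeometric series at 1, and Euler's transformation -/

theorem tendsto_choose_div_pow (k : ℕ) :
    Tendsto (fun n : ℕ => ((n + k).choose k : ℂ) / (n : ℂ) ^ k) atTop
      (𝓝 ((k.factorial : ℂ)⁻¹)) := by
  induction k with
  | zero => simp
  | succ k ih =>
    have h1 : Tendsto (fun n : ℕ => (1 : ℂ) + ((k + 1 : ℕ) : ℂ) / (n : ℂ)) atTop (𝓝 (1 + 0)) :=
      tendsto_const_nhds.add (tendsto_const_div_atTop_nhds_zero_nat _)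
    have h2 := (ih.mul h1).mul_const ((k + 1 : ℂ)⁻¹)
    have e : (((k + 1).factorial : ℕ) : ℂ)⁻¹ = (k.factorial : ℂ)⁻¹ * (1 + 0) * (k + 1 : ℂ)⁻¹ := by
      rw [Nat.factorial_succ]
      push_cast
      rw [mul_inv]
      ring
    rw [e]
    refine h2.congr' ?_
    filter_upwards [eventually_ge_atTop 1] with n hn
    have hn0 : (n : ℂ) ≠ 0 := Nat.cast_ne_zero.2 (by omega)
    have hk : (k + 1 : ℂ) ≠ 0 := by exact_mod_cast k.succ_ne_zero
    have h3 := Nat.add_one_mul_choose_eq (n + k) k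
    have h4 : ((n + k + 1 : ℕ) : ℂ) * ((n + k).choose k : ℂ) =
        ((n + (k + 1)).choose (k + 1) : ℂ) * ((k + 1 : ℕ) : ℂ) := by exact_mod_cast h3
    push_cast at h4 ⊢
    field_simp
    linear_combination (n : ℂ) * (n : ℂ) ^ k * h4

/-- An Abelian theorem: the growth of the coefficients of a power series determines its growth
at the boundary point `1`. -/
theorem DiscSummable.tendsto_one_sub_pow_mul {d : ℕ → ℂ} (hd : DiscSummable d) (k : ℕ) {L : ℂ}
    (h : Tendsto (fun n : ℕ => d n / (n : ℂ) ^ k) atTop (𝓝 L)) :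
    Tendsto (fun x : ℝ => (1 - (x : ℂ)) ^ (k + 1) * ∑' n, d n * (x : ℂ) ^ n) (𝓝[<] 1)
      (𝓝 (k.factorial * L)) := by
  have hkf : (k.factorial : ℂ) ≠ 0 := Nat.cast_ne_zero.2 k.factorial_ne_zero
  set M : ℂ := k.factorial * L with hM
  have h1 : Tendsto (fun n : ℕ => d n / ((n + k).choose k : ℂ)) atTop (𝓝 M) := by
    have := h.div (tendsto_choose_div_pow k) (inv_ne_zero hkf)
    rw [div_inv_eq_mul, mul_comm] at this
    refine this.congr' ?_
    filter_upwards [eventually_ge_atTop 1] with n hn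
    have hn0 : (n : ℂ) ≠ 0 := Nat.cast_ne_zero.2 (by omega)
    simp only [Pi.div_apply]
    field_simp
  rw [Metric.tendsto_nhds]
  intro δ hδ
  obtain ⟨N, hN⟩ := Metric.tendsto_atTop.1 h1 (δ / 2) (by positivity)
  -- Comparison with M (1 - x)^{-(k+1)} = M ∑ C(n+k, k) x^n: the difference has coefficients `c`,
  -- whose tail is small relative to C(n+k, k) and whose head contributes at most the constant `C`.
  set c : ℕ → ℂ := fun n => d n - M * ((n + k).choose k : ℂ) with hc
  have hcN : ∀ n, N ≤ n → ‖c n‖ ≤ δ / 2 * ((n + k).choose k : ℝ) := by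
    intro n hn
    have hB : 0 < (n + k).choose k := Nat.choose_pos (by omega)
    have hB' : ((n + k).choose k : ℂ) ≠ 0 := Nat.cast_ne_zero.2 hB.ne'
    have e : c n = (d n / ((n + k).choose k : ℂ) - M) * ((n + k).choose k : ℂ) := by
      simp only [hc]
      field_simp
    rw [e, norm_mul, Complex.norm_natCast]
    have := hN n hn
    rw [dist_eq_norm] at this
    gcongr
  set C : ℝ := ∑ n ∈ Finset.range N, ‖c n‖ with hC
  have hCt : Tendsto (fun x : ℝ => δ / 2 + C * (1 - x) ^ (k + 1)) (𝓝[<] 1)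
      (𝓝 (δ / 2 + C * (1 - 1) ^ (k + 1))) := by
    refine Tendsto.mono_left (Continuous.tendsto ?_ 1) nhdsWithin_le_nhds
    fun_prop
  have hev : ∀ᶠ x : ℝ in 𝓝[<] 1, δ / 2 + C * (1 - x) ^ (k + 1) < δ :=
    hCt.eventually_lt_const (by simp; linarith)
  have h01 : ∀ᶠ x : ℝ in 𝓝[<] 1, x ∈ Ioo (0 : ℝ) 1 := Ioo_mem_nhdsLT zero_lt_one
  filter_upwards [hev, h01] with x hx1 hx
  have hx0 : (0 : ℝ) < 1 - x := by linarith [hx.2]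
  have hxn : ‖(x : ℂ)‖ < 1 := by rw [Complex.norm_real, Real.norm_of_nonneg hx.1.le]; exact hx.2
  have hxr : ‖x‖ < 1 := by rw [Real.norm_of_nonneg hx.1.le]; exact hx.2
  have hgC := hasSum_choose_mul_geometric_of_norm_lt_one k hxn
  have hgR := hasSum_choose_mul_geometric_of_norm_lt_one k hxr
  have hsub := (hd.summable hxn).hasSum.sub (hgC.mul_left M)
  have hx0' : (1 - (x : ℂ)) ≠ 0 := by exact_mod_cast hx0.ne'
  have hfin : Summable fun n => if n < N then ‖c n‖ else 0 :=
    summable_of_ne_finset_zero (s := Finset.range N) (fun n hn => by simp_all)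
  have hfin' : ∑' n, (if n < N then ‖c n‖ else 0) = C := by
    rw [tsum_eq_sum (s := Finset.range N) (fun n hn => by simp_all), hC]
    exact Finset.sum_congr rfl fun n hn => by simp_all
  have hbnd := (hgR.mul_left (δ / 2)).add hfin.hasSum
  have hle : ‖∑' n, d n * (x : ℂ) ^ n - M * (1 / (1 - (x : ℂ)) ^ (k + 1))‖ ≤
      δ / 2 * (1 / (1 - x) ^ (k + 1)) + C := by
    rw [← hfin', ← hsub.tsum_eq, ← hbnd.tsum_eq]
    refine tsum_of_norm_bounded hbnd.summable.hasSum fun n => ?_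
    have e : d n * (x : ℂ) ^ n - M * (((n + k).choose k : ℂ) * (x : ℂ) ^ n) = c n * (x : ℂ) ^ n := by
      simp only [hc]; ring
    rw [e, norm_mul, norm_pow, Complex.norm_real, Real.norm_of_nonneg hx.1.le]
    have hp : x ^ n ≤ 1 := pow_le_one₀ hx.1.le hx.2.le
    have hp0 : 0 ≤ x ^ n := pow_nonneg hx.1.le n
    split_ifs with hn
    · have : 0 ≤ δ / 2 * (((n + k).choose k : ℝ) * x ^ n) := by positivity
      nlinarith [norm_nonneg (c n)]
    · have := hcN n (not_lt.1 hn)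
      nlinarith
  rw [dist_eq_norm]
  have e : (1 - (x : ℂ)) ^ (k + 1) * ∑' n, d n * (x : ℂ) ^ n - M =
      (1 - (x : ℂ)) ^ (k + 1) * (∑' n, d n * (x : ℂ) ^ n - M * (1 / (1 - (x : ℂ)) ^ (k + 1))) := by
    field_simp
  have en : ‖(1 - (x : ℂ))‖ = 1 - x := by
    rw [← Complex.ofReal_one, ← Complex.ofReal_sub, Complex.norm_real, Real.norm_of_nonneg hx0.le]
  rw [e, norm_mul, norm_pow, en]
  refine lt_of_le_of_lt ?_ hx1
  have hp : 0 < (1 - x) ^ (k + 1) := by positivity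
  calc (1 - x) ^ (k + 1) * _ ≤ (1 - x) ^ (k + 1) * (δ / 2 * (1 / (1 - x) ^ (k + 1)) + C) := by gcongr
    _ = _ := by field_simp

theorem ascPochhammer_eval_eq_prod (s : ℂ) (n : ℕ) :
    (ascPochhammer ℂ n).eval s = ∏ j ∈ Finset.range n, (s + j) := by
  induction n with
  | zero => simp
  | succ n ih => rw [ascPochhammer_succ_eval, Finset.prod_range_succ, ih]

/-- The growth of the coefficients of the derivative of a hypergeometric series. -/
theorem tendsto_derivCoeff_hypCoeff {a b c : ℂ} {k : ℕ} (hk : a + b = c + k)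
    (ha : ∀ j : ℕ, a ≠ -(j : ℂ)) (hb : ∀ j : ℕ, b ≠ -(j : ℂ)) (hc : ∀ j : ℕ, c ≠ -(j : ℂ)) :
    Tendsto (fun n : ℕ => derivCoeff (hypCoeff a b c) n / (n : ℂ) ^ k) atTop
      (𝓝 (Complex.Gamma c / (Complex.Gamma a * Complex.Gamma b))) := by
  -- `GammaSeq s n` is n^s n! / (s)_{n+1}; for n ≥ 1 the quotient of the three sequences equals the
  -- sequence in question exactly, because a + b - c = k.
  have h := (Complex.GammaSeq_tendsto_Gamma c).div
    ((Complex.GammaSeq_tendsto_Gamma a).mul (Complex.GammaSeq_tendsto_Gamma b))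
    (mul_ne_zero (Complex.Gamma_ne_zero ha) (Complex.Gamma_ne_zero hb))
  refine h.congr' ?_
  filter_upwards [eventually_ge_atTop 1] with n hn
  have hn0 : (n : ℂ) ≠ 0 := Nat.cast_ne_zero.2 (by omega)
  have h1 := ascPochhammer_eval_ne_zero ha (n + 1)
  have h2 := ascPochhammer_eval_ne_zero hb (n + 1)
  have h3 := ascPochhammer_eval_ne_zero hc (n + 1)
  have hnf : (n.factorial : ℂ) ≠ 0 := Nat.cast_ne_zero.2 n.factorial_ne_zero
  have hn1 : (n + 1 : ℂ) ≠ 0 := by exact_mod_cast n.succ_ne_zero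
  have hca : (n : ℂ) ^ a * (n : ℂ) ^ b = (n : ℂ) ^ c * (n : ℂ) ^ k := by
    rw [← Complex.cpow_add _ _ hn0, hk, Complex.cpow_add _ _ hn0, Complex.cpow_natCast]
  have hb0 : (n : ℂ) ^ b ≠ 0 := by simp [Complex.cpow_eq_zero_iff, hn0]
  have ha0 : (n : ℂ) ^ a ≠ 0 := by simp [Complex.cpow_eq_zero_iff, hn0]
  simp only [Pi.div_apply, Complex.GammaSeq, ← ascPochhammer_eval_eq_prod, derivCoeff, hypCoeff,
    ordinaryHypergeometricCoefficient, Nat.factorial_succ]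
  push_cast
  field_simp
  rw [← hca]

/-- The coefficients are those of the derivative divided by the index, hence one order smaller. At
the order at which the derivative blows up, the function itself is therefore negligible. -/
theorem tendsto_hypCoeff_div_pow {a b c : ℂ} {k : ℕ} (hk : a + b = c + k)
    (ha : ∀ j : ℕ, a ≠ -(j : ℂ)) (hb : ∀ j : ℕ, b ≠ -(j : ℂ)) (hc : ∀ j : ℕ, c ≠ -(j : ℂ)) :
    Tendsto (fun n : ℕ => hypCoeff a b c n / (n : ℂ) ^ k) atTop (𝓝 0) := by
  rw [← tendsto_add_atTop_iff_nat 1]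
  have h1 : Tendsto (fun n : ℕ => 1 / ((n : ℂ) + 1)) atTop (𝓝 0) :=
    tendsto_one_div_add_atTop_nhds_zero_nat
  have h2 : Tendsto (fun n : ℕ => (1 - 1 / ((n : ℂ) + 1)) ^ k) atTop (𝓝 ((1 - 0) ^ k)) :=
    (tendsto_const_nhds.sub h1).pow k
  have h := ((tendsto_derivCoeff_hypCoeff hk ha hb hc).mul h2).mul h1
  rw [mul_zero] at h
  refine h.congr' ?_
  filter_upwards [eventually_ge_atTop 1] with n hn
  have hn0 : (n : ℂ) ≠ 0 := Nat.cast_ne_zero.2 (by omega)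
  have hn1 : (n + 1 : ℂ) ≠ 0 := by exact_mod_cast n.succ_ne_zero
  have e : (1 - 1 / ((n : ℂ) + 1)) = n / (n + 1) := by field_simp; ring
  simp only [derivCoeff]
  rw [e, div_pow]
  push_cast
  field_simp

/-- Euler's transformation of the hypergeometric function. -/
theorem ordinaryHypergeometric_euler (a b : ℂ) {c : ℂ} (hc : ∀ k : ℕ, c ≠ -(k : ℂ)) {z : ℂ}
    (hz : ‖z‖ < 1) :
    ₂F₁ a b c z = (1 - z) ^ (c - a - b) * ₂F₁ (c - a) (c - b) c z := by
  have hre : ∀ z ∈ Metric.ball (0 : ℂ) 1, 1 - z ∈ Complex.slitPlane := by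
    intro z hz
    refine Or.inl ?_
    have := (Complex.re_le_norm z).trans_lt (mem_ball_zero_iff.1 hz)
    simp
    linarith
  have hF : ∀ a b : ℂ, DifferentiableOn ℂ (₂F₁ a b c : ℂ → ℂ) (Metric.ball 0 1) := fun a b z hz =>
    (hasDerivAt_ordinaryHypergeometric a b c (mem_ball_zero_iff.1 hz)).differentiableAt.differentiableWithinAt
  have hG : DifferentiableOn ℂ (fun z : ℂ => (1 - z) ^ (c - a - b) * ₂F₁ (c - a) (c - b) c z)
      (Metric.ball 0 1) := by
    refine DifferentiableOn.mul ?_ (hF _ _)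
    intro z hz
    refine DifferentiableAt.differentiableWithinAt ?_
    exact DifferentiableAt.cpow (by fun_prop) (by fun_prop) (hre z hz)
  refine ((hF a b).analyticOnNhd Metric.isOpen_ball).eqOn_of_preconnected_of_eventuallyEq
    (hG.analyticOnNhd Metric.isOpen_ball) (convex_ball (0 : ℂ) 1).isPreconnected
    (z₀ := 0) (by simp) ?_ (mem_ball_zero_iff.2 hz)
  -- For |z| < 1/3 both z and z/(z - 1) have modulus below 1/2, so Pfaff's transformation applies at
  -- each of them. Two applications give Euler's formula here, and the identity theorem extends it
  -- to the disc.
  filter_upwards [Metric.ball_mem_nhds (0 : ℂ) (show (0 : ℝ) < 1 / 3 by norm_num)] with z hz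
  have hz3 : ‖z‖ < 1 / 3 := mem_ball_zero_iff.1 hz
  have hz1 : 1 - z ∈ Complex.slitPlane := hre z (mem_ball_zero_iff.2 (by linarith))
  have hz0 : 1 - z ≠ 0 := Complex.slitPlane_ne_zero hz1
  have hz0' : z - 1 ≠ 0 := by rw [← neg_sub]; exact neg_ne_zero.2 hz0
  have hw : ‖z / (z - 1)‖ < 1 / 2 := by
    have : 1 - ‖z‖ ≤ ‖z - 1‖ := by
      have := norm_sub_norm_le (1 : ℂ) z
      rwa [norm_one, norm_sub_rev] at this
    rw [norm_div, div_lt_iff₀ (by linarith)]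
    linarith
  have h1 := gaussHypergeometric_eq_ordinaryHypergeometric a b c hc
    (show ‖z‖ < 1 / 2 by linarith)
  have h2 := gaussHypergeometric_eq_ordinaryHypergeometric (c - b) a c hc hw
  have e1 : 1 - z / (z - 1) = (1 - z)⁻¹ := by field_simp; ring
  have e2 : z / (z - 1) / (z / (z - 1) - 1) = z := by
    have : z / (z - 1) - 1 = (z - 1)⁻¹ := by field_simp; ring
    rw [this]
    field_simp
  have harg : (1 - z).arg ≠ Real.pi := Complex.slitPlane_arg_ne_pi hz1
  rw [gaussHypergeometric, e1, e2, Complex.inv_cpow _ _ harg, Complex.cpow_neg, inv_inv] at h2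
  have sym : ∀ a b z : ℂ, ₂F₁ a b c z = ₂F₁ b a c z := by
    intro a b z
    simp only [ordinaryHypergeometric, ordinaryHypergeometricSeries_symm]
  rw [← h1, gaussHypergeometric, sym, ← h2, ← mul_assoc, ← Complex.cpow_add _ _ hz0, sym]
  congr 2
  ring

/-! ### The differential equation in ξ, its solutions and their Wronskians -/

/-- `f` is, with derivative `f'`, a solution on `(0, ∞)` of
`f'' + (2 m + 1) coth ξ f' + (m + s) (m + 1 - s) f = 0`, the equation satisfied by
`(sinh ξ)^(-m) P^(-m)_(s-1)(cosh ξ)`. -/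
def IsGegenbauerSol (m : ℕ) (s : ℂ) (f f' : ℂ → ℂ) : Prop :=
  ∀ ξ : ℝ, 0 < ξ → HasDerivAt f (f' ξ) (ξ : ℂ) ∧
    HasDerivAt f' (-(2 * m + 1) * (Complex.cosh ξ / Complex.sinh ξ) * f' ξ -
      (m + s) * (m + 1 - s) * f ξ) (ξ : ℂ)

/-- The Wronskian of two functions, multiplied by the integrating factor of the equation. -/
noncomputable def wronskian (m : ℕ) (f f' g g' : ℂ → ℂ) (ξ : ℝ) : ℂ :=
  (2 * Complex.sinh ξ) ^ (2 * m + 1) * (f ξ * g' ξ - f' ξ * g ξ)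

theorem sinh_ofReal_ne_zero {ξ : ℝ} (hξ : 0 < ξ) : Complex.sinh ξ ≠ 0 := by
  rw [← Complex.ofReal_sinh]
  exact_mod_cast (Real.sinh_pos_iff.2 hξ).ne'

/-- Abel's identity: the plain Wronskian satisfies W' = -(2m+1) coth ξ · W, which the factor (sinh
ξ)^{2m+1} compensates. -/
theorem IsGegenbauerSol.wronskian_eq {m : ℕ} {s : ℂ} {f f' g g' : ℂ → ℂ}
    (hf : IsGegenbauerSol m s f f') (hg : IsGegenbauerSol m s g g') {ξ η : ℝ} (hξ : 0 < ξ)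
    (hη : 0 < η) : wronskian m f f' g g' ξ = wronskian m f f' g g' η := by
  have hd : ∀ ξ : ℝ, 0 < ξ → HasDerivAt (wronskian m f f' g g') 0 ξ := by
    intro ξ hξ
    obtain ⟨h1, h2⟩ := hf ξ hξ
    obtain ⟨h3, h4⟩ := hg ξ hξ
    have h := ((((Complex.hasDerivAt_sinh (ξ : ℂ)).const_mul 2).pow (2 * m + 1)).mul
      ((h1.mul h4).sub (h2.mul h3))).comp_ofReal
    refine (h.congr_deriv ?_)
    have hs := sinh_ofReal_ne_zero hξ
    simp only [Nat.add_sub_cancel, Pi.pow_apply, Pi.mul_apply, Pi.sub_apply]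
    push_cast
    field_simp
    ring
  have hdiff : DifferentiableOn ℝ (wronskian m f f' g g') (Ioi 0) := fun x hx =>
    (hd x hx).differentiableAt.differentiableWithinAt
  exact isOpen_Ioi.is_const_of_deriv_eq_zero isPreconnected_Ioi hdiff
    (fun x hx => (hd x hx).deriv) hξ hη

/-- The solution which behaves like `e^(-(m+s)ξ)` at infinity. -/
noncomputable def recSol (m : ℕ) (s ζ : ℂ) : ℂ :=
  Complex.exp (-(m + s) * ζ) *
    ₂F₁ (m + s) (m + 1 / 2 : ℂ) (s + 1 / 2) (Complex.exp (-2 * ζ))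

/-- The derivative of `recSol`. -/
noncomputable def recSolDeriv (m : ℕ) (s ζ : ℂ) : ℂ :=
  Complex.exp (-(m + s) * ζ) *
    (-(m + s) * ₂F₁ (m + s) (m + 1 / 2 : ℂ) (s + 1 / 2) (Complex.exp (-2 * ζ)) -
      2 * Complex.exp (-2 * ζ) *
        hypDeriv (m + s) (m + 1 / 2 : ℂ) (s + 1 / 2) (Complex.exp (-2 * ζ)))

theorem ne_neg_natCast_of_re_pos {c : ℂ} (hc : 0 < c.re) (k : ℕ) : c ≠ -(k : ℂ) := by
  rintro rfl
  simp at hc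
  have : (0 : ℝ) ≤ k := k.cast_nonneg
  linarith

theorem norm_exp_neg_two_mul_lt_one {ξ : ℝ} (hξ : 0 < ξ) : ‖Complex.exp (-2 * (ξ : ℂ))‖ < 1 := by
  rw [Complex.norm_exp, Real.exp_lt_one_iff]
  simp
  linarith

/-- After the factor e^{-(m+s)ξ} is split off, the substitution ε = e^{-2ξ} turns the equation into
the hypergeometric one. -/
theorem isGegenbauerSol_recSol (m : ℕ) {s : ℂ} (hs : 0 < s.re) :
    IsGegenbauerSol m s (recSol m s) (recSolDeriv m s) := by
  intro ξ hξ
  have hε := norm_exp_neg_two_mul_lt_one hξ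
  have hc : ∀ k : ℕ, s + 1 / 2 ≠ -(k : ℂ) :=
    ne_neg_natCast_of_re_pos (by simp; linarith)
  have dε : HasDerivAt (fun ζ : ℂ => Complex.exp (-2 * ζ)) (Complex.exp (-2 * (ξ : ℂ)) * -2) ξ := by
    simpa using ((hasDerivAt_id (ξ : ℂ)).const_mul (-2)).cexp
  have dA : HasDerivAt (fun ζ : ℂ => Complex.exp (-(m + s) * ζ))
      (Complex.exp (-(m + s) * (ξ : ℂ)) * -(m + s)) ξ := by
    simpa using ((hasDerivAt_id (ξ : ℂ)).const_mul (-(m + s))).cexp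
  have dF := HasDerivAt.comp (h := fun ζ : ℂ => Complex.exp (-2 * ζ)) (ξ : ℂ)
    (hasDerivAt_ordinaryHypergeometric (m + s) (m + 1 / 2) (s + 1 / 2) hε) dε
  have dF' := HasDerivAt.comp (h := fun ζ : ℂ => Complex.exp (-2 * ζ)) (ξ : ℂ)
    (hasDerivAt_hypDeriv (m + s) (m + 1 / 2) (s + 1 / 2) hε) dε
  have ode := hypergeometric_ode (m + s) (m + 1 / 2) hc hε
  refine ⟨(dA.mul dF).congr_deriv ?_, (dA.mul ((dF.const_mul (-(m + s))).sub
    ((dε.const_mul 2).mul dF'))).congr_deriv ?_⟩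
  · simp only [recSolDeriv, Function.comp]
    ring
  · have hS := sinh_ofReal_ne_zero hξ
    have hε1 : 1 - Complex.exp (-2 * (ξ : ℂ)) ≠ 0 := by
      intro h
      rw [← sub_eq_zero.1 h, norm_one] at hε
      exact lt_irrefl _ hε
    have hcoth : Complex.cosh ξ / Complex.sinh ξ =
        (1 + Complex.exp (-2 * (ξ : ℂ))) / (1 - Complex.exp (-2 * (ξ : ℂ))) := by
      rw [div_eq_div_iff hS hε1, Complex.cosh, Complex.sinh,
        show -2 * (ξ : ℂ) = -ξ + -ξ by ring, Complex.exp_add]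
      have : Complex.exp (ξ : ℂ) * Complex.exp (-ξ : ℂ) = 1 := by
        rw [← Complex.exp_add]; simp
      linear_combination (-Complex.exp (-ξ : ℂ)) * this
    rw [hcoth]
    simp only [recSol, recSolDeriv, Function.comp, Pi.mul_apply, Pi.sub_apply]
    generalize Complex.exp (-2 * (ξ : ℂ)) = ε at *
    generalize Complex.exp (-(m + s) * (ξ : ℂ)) = A at *
    generalize ₂F₁ (m + s) (m + 1 / 2) (s + 1 / 2) ε = F at *
    generalize hypDeriv (m + s) (m + 1 / 2) (s + 1 / 2) ε = F' at *
    generalize hypDeriv₂ (m + s) (m + 1 / 2) (s + 1 / 2) ε = F'' at *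
    field_simp
    linear_combination (2 * A * ε) * ode * 2

/-- The solution in `u = cosh ξ` which is regular at `u = 1`. -/
noncomputable def regSol (m : ℕ) (s u : ℂ) : ℂ :=
  ((1 + u) / 2) ^ (-(m + 1 - s)) *
    ₂F₁ (m + 1 - s) (1 - s) (m + 1 : ℂ) ((u - 1) / (u + 1))

/-- The derivative of `regSol`. -/
noncomputable def regSolDeriv (m : ℕ) (s u : ℂ) : ℂ :=
  ((1 + u) / 2) ^ (-(m + 1 - s)) *
    (-(m + 1 - s) / (1 + u) * ₂F₁ (m + 1 - s) (1 - s) (m + 1 : ℂ) ((u - 1) / (u + 1)) +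
      2 / (u + 1) ^ 2 * hypDeriv (m + 1 - s) (1 - s) (m + 1 : ℂ) ((u - 1) / (u + 1)))

theorem norm_sub_one_div_add_one_lt_one {u : ℂ} (hu : 0 < u.re) : ‖(u - 1) / (u + 1)‖ < 1 := by
  have h1 : u + 1 ≠ 0 := by
    intro h
    have := congrArg Complex.re h
    simp at this
    linarith
  rw [norm_div, div_lt_one (norm_pos_iff.2 h1), ← sq_lt_sq₀ (norm_nonneg _) (norm_nonneg _),
    ← Complex.normSq_eq_norm_sq, ← Complex.normSq_eq_norm_sq, Complex.normSq_apply,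
    Complex.normSq_apply]
  simp
  nlinarith

/-- The variable w = (u - 1)/(u + 1) sends u = 1 to the origin and the half-plane Re u > 0 into the
unit disc. The equation obtained is the one of `IsGegenbauerSol` written in u = cosh ξ; the second
derivative matters only through it. -/
theorem hasDerivAt_regSol (m : ℕ) (s : ℂ) {u : ℂ} (hu : 0 < u.re) :
    HasDerivAt (regSol m s) (regSolDeriv m s u) u ∧
      ∃ H'' : ℂ, HasDerivAt (regSolDeriv m s) H'' u ∧
        (u ^ 2 - 1) * H'' + 2 * (m + 1) * u * regSolDeriv m s u +
          (m + s) * (m + 1 - s) * regSol m s u = 0 := by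
  have hw := norm_sub_one_div_add_one_lt_one hu
  have h1 : u + 1 ≠ 0 := by
    intro h
    have := congrArg Complex.re h
    simp at this
    linarith
  have h1' : 1 + u ≠ 0 := by rwa [add_comm]
  have hc : ∀ k : ℕ, (m + 1 : ℂ) ≠ -(k : ℂ) :=
    ne_neg_natCast_of_re_pos (by simp; positivity)
  have hslit : (1 + u) / 2 ∈ Complex.slitPlane := by
    refine Or.inl ?_
    simp
    linarith
  have dw : HasDerivAt (fun u : ℂ => (u - 1) / (u + 1)) (2 / (u + 1) ^ 2) u := by
    refine (((hasDerivAt_id u).sub_const 1).div ((hasDerivAt_id u).add_const 1) h1).congr_deriv ?_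
    simp
    ring
  have dg : HasDerivAt (fun u : ℂ => ((1 + u) / 2) ^ (-(m + 1 - s)))
      (((1 + u) / 2) ^ (-(m + 1 - s)) * (-(m + 1 - s) / (1 + u))) u := by
    have hb : HasDerivAt (fun u : ℂ => (1 + u) / 2) (1 / 2) u :=
      ((hasDerivAt_id u).const_add 1).div_const 2
    refine (hb.cpow_const hslit).congr_deriv ?_
    rw [Complex.cpow_sub _ _ (Complex.slitPlane_ne_zero hslit), Complex.cpow_one]
    field_simp
  have da : HasDerivAt (fun u : ℂ => -(m + 1 - s) / (1 + u)) ((m + 1 - s) / (1 + u) ^ 2) u := by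
    refine ((hasDerivAt_const u (-(m + 1 - s))).div ((hasDerivAt_id u).const_add 1)
      h1').congr_deriv ?_
    simp
  have db : HasDerivAt (fun u : ℂ => 2 / (u + 1) ^ 2) (-4 / (u + 1) ^ 3) u := by
    refine ((hasDerivAt_const u (2 : ℂ)).div (((hasDerivAt_id u).add_const 1).pow 2)
      (pow_ne_zero 2 h1)).congr_deriv ?_
    simp
    field_simp
    ring
  have dF := HasDerivAt.comp (h := fun u : ℂ => (u - 1) / (u + 1)) u
    (hasDerivAt_ordinaryHypergeometric (m + 1 - s) (1 - s) (m + 1) hw) dw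
  have dF' := HasDerivAt.comp (h := fun u : ℂ => (u - 1) / (u + 1)) u
    (hasDerivAt_hypDeriv (m + 1 - s) (1 - s) (m + 1) hw) dw
  have ode := hypergeometric_ode (m + 1 - s) (1 - s) hc hw
  refine ⟨(dg.mul dF).congr_deriv ?_, _, dg.mul ((da.mul dF).add (db.mul dF')), ?_⟩
  · simp only [regSolDeriv, Function.comp]
    ring
  · simp only [regSol, regSolDeriv, Function.comp]
    generalize ((1 + u) / 2) ^ (-(m + 1 - s)) = g at *
    generalize ₂F₁ (m + 1 - s) (1 - s) (m + 1 : ℂ) ((u - 1) / (u + 1)) = F at *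
    generalize hypDeriv (m + 1 - s) (1 - s) (m + 1 : ℂ) ((u - 1) / (u + 1)) = F' at *
    generalize hypDeriv₂ (m + 1 - s) (1 - s) (m + 1 : ℂ) ((u - 1) / (u + 1)) = F'' at *
    rw [add_comm 1 u]
    field_simp at ode ⊢
    linear_combination (2 * g * (u + 1)) * ode

theorem isGegenbauerSol_regSol (m : ℕ) (s : ℂ) :
    IsGegenbauerSol m s (fun ζ => regSol m s (Complex.cosh ζ))
      (fun ζ => Complex.sinh ζ * regSolDeriv m s (Complex.cosh ζ)) := by
  intro ξ hξ
  have hre : 0 < (Complex.cosh (ξ : ℂ)).re := by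
    rw [← Complex.ofReal_cosh, Complex.ofReal_re]
    exact Real.cosh_pos ξ
  obtain ⟨h1, H'', h2, h3⟩ := hasDerivAt_regSol m s hre
  have hS := sinh_ofReal_ne_zero hξ
  have hC := Complex.hasDerivAt_cosh (ξ : ℂ)
  refine ⟨(h1.comp _ hC).congr_deriv (by ring),
    ((Complex.hasDerivAt_sinh (ξ : ℂ)).mul (h2.comp _ hC)).congr_deriv ?_⟩
  have hcs := Complex.cosh_sq (ξ : ℂ)
  simp only [Function.comp]
  rw [hcs] at h3
  field_simp
  linear_combination h3

/-- The equation depends on s only through (m + s)(m + 1 - s). Thus `recSol m (1 - s)` is a second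
solution for the same s. -/
theorem IsGegenbauerSol.one_sub {m : ℕ} {s : ℂ} {f f' : ℂ → ℂ}
    (h : IsGegenbauerSol m (1 - s) f f') : IsGegenbauerSol m s f f' := by
  intro ξ hξ
  obtain ⟨h1, h2⟩ := h ξ hξ
  exact ⟨h1, h2.congr_deriv (by ring)⟩

theorem two_mul_sinh_eq (ζ : ℂ) :
    2 * Complex.sinh ζ = Complex.exp ζ * (1 - Complex.exp (-2 * ζ)) := by
  rw [Complex.two_sinh, mul_sub, ← Complex.exp_add, mul_one]
  congr 2
  ring

/-- The value is the limit at ξ → ∞. The exponentials cancel since (m + s) + (m + 1 - s) = 2m + 1,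
leaving a function Φ of ε = e^{-2ξ} that is continuous at 0. -/
theorem wronskian_recSol {m : ℕ} {s : ℂ} (h0 : 0 < s.re) (h1 : s.re < 1) {ξ : ℝ} (hξ : 0 < ξ) :
    wronskian m (recSol m s) (recSolDeriv m s) (recSol m (1 - s)) (recSolDeriv m (1 - s)) ξ =
      2 * s - 1 := by
  have sol1 := isGegenbauerSol_recSol m h0
  have sol2 := (isGegenbauerSol_recSol m (s := 1 - s) (by simpa using h1)).one_sub
  set a := (m + s : ℂ) with ha
  set a' := (m + (1 - s) : ℂ) with ha'
  set b := (m + 1 / 2 : ℂ) with hb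
  set Φ : ℂ → ℂ := fun ε => (1 - ε) ^ (2 * m + 1) *
    (₂F₁ a b (s + 1 / 2) ε * (-a' * ₂F₁ a' b (1 - s + 1 / 2) ε -
        2 * ε * hypDeriv a' b (1 - s + 1 / 2) ε) -
      (-a * ₂F₁ a b (s + 1 / 2) ε - 2 * ε * hypDeriv a b (s + 1 / 2) ε) *
        ₂F₁ a' b (1 - s + 1 / 2) ε) with hΦ
  have hF : ∀ a b c : ℂ, ContinuousAt (₂F₁ a b c) (0 : ℂ) := fun a b c =>
    (hasDerivAt_ordinaryHypergeometric a b c (by simp)).continuousAt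
  have hF' : ∀ a b c : ℂ, ContinuousAt (hypDeriv a b c) (0 : ℂ) := fun a b c =>
    (hasDerivAt_hypDeriv a b c (by simp)).continuousAt
  have hcont : ContinuousAt Φ 0 := by
    have e1 := hF a b (s + 1 / 2)
    have e2 := hF a' b (1 - s + 1 / 2)
    have e3 := hF' a b (s + 1 / 2)
    have e4 := hF' a' b (1 - s + 1 / 2)
    simp only [hΦ]
    fun_prop
  have hΦ0 : Φ 0 = 2 * s - 1 := by
    simp only [hΦ, ordinaryHypergeometric_zero, ha, ha']
    simp
    ring
  have hexp : Tendsto (fun η : ℝ => Complex.exp (-2 * (η : ℂ))) atTop (𝓝 0) := by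
    rw [tendsto_zero_iff_norm_tendsto_zero]
    have : Tendsto (fun η : ℝ => Real.exp (-(2 * η))) atTop (𝓝 0) :=
      Real.tendsto_exp_neg_atTop_nhds_zero.comp (tendsto_id.const_mul_atTop two_pos)
    refine this.congr fun η => ?_
    rw [Complex.norm_exp]
    simp
  have hlim := (hΦ0 ▸ hcont.tendsto).comp hexp
  have hW : ∀ η : ℝ, wronskian m (recSol m s) (recSolDeriv m s) (recSol m (1 - s))
      (recSolDeriv m (1 - s)) η = Φ (Complex.exp (-2 * (η : ℂ))) := by
    intro η
    have hE : Complex.exp (η : ℂ) ^ (2 * m + 1) *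
        (Complex.exp (-a * (η : ℂ)) * Complex.exp (-a' * (η : ℂ))) = 1 := by
      rw [← Complex.exp_nat_mul, ← Complex.exp_add, ← Complex.exp_add, Complex.exp_eq_one_iff]
      refine ⟨0, ?_⟩
      rw [ha, ha']
      push_cast
      ring
    simp only [wronskian, recSol, recSolDeriv, two_mul_sinh_eq, hΦ, mul_pow, ← ha, ← ha', ← hb]
    linear_combination ((1 - Complex.exp (-2 * (η : ℂ))) ^ (2 * m + 1) *
      (₂F₁ a b (s + 1 / 2) (Complex.exp (-2 * (η : ℂ))) *
        (-a' * ₂F₁ a' b (1 - s + 1 / 2) (Complex.exp (-2 * (η : ℂ))) -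
          2 * Complex.exp (-2 * (η : ℂ)) * hypDeriv a' b (1 - s + 1 / 2) (Complex.exp (-2 * (η : ℂ)))) -
      (-a * ₂F₁ a b (s + 1 / 2) (Complex.exp (-2 * (η : ℂ))) -
          2 * Complex.exp (-2 * (η : ℂ)) * hypDeriv a b (s + 1 / 2) (Complex.exp (-2 * (η : ℂ)))) *
        ₂F₁ a' b (1 - s + 1 / 2) (Complex.exp (-2 * (η : ℂ))))) * hE
  refine tendsto_nhds_unique (tendsto_const_nhds.congr' ?_) hlim
  filter_upwards [eventually_gt_atTop 0] with η hη
  rw [sol1.wronskian_eq sol2 hξ hη, hW]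
  rfl

theorem tendsto_exp_neg_two_mul : Tendsto (fun η : ℝ => Real.exp (-2 * η)) (𝓝[>] 0) (𝓝[<] 1) := by
  refine tendsto_nhdsWithin_iff.2 ⟨?_, ?_⟩
  · have : Continuous fun η : ℝ => Real.exp (-2 * η) := by fun_prop
    have h := this.tendsto 0
    simp only [mul_zero, Real.exp_zero] at h
    exact h.mono_left nhdsWithin_le_nhds
  · filter_upwards [self_mem_nhdsWithin] with η hη
    have : (0 : ℝ) < η := hη
    simp only [mem_Iio, Real.exp_lt_one_iff]
    linarith

/-- The value is the limit at ξ → 0+. There the regular solution tends to 1 and its derivative to 0,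
so only the singularity of order 2m + 1 of the derivative of `recSol` contributes; the Abelian
theorem with k = 2m measures it. -/
theorem wronskian_recSol_regSol {m : ℕ} {s : ℂ} (h0 : 0 < s.re) {ξ : ℝ} (hξ : 0 < ξ) :
    wronskian m (recSol m s) (recSolDeriv m s) (fun ζ => regSol m s (Complex.cosh ζ))
      (fun ζ => Complex.sinh ζ * regSolDeriv m s (Complex.cosh ζ)) ξ =
      2 * (((2 * m).factorial : ℂ) * (Complex.Gamma (s + 1 / 2) /
        (Complex.Gamma (m + s) * Complex.Gamma (m + 1 / 2)))) := by
  have sol1 := isGegenbauerSol_recSol m h0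
  have sol2 := isGegenbauerSol_regSol m s
  set a := (m + s : ℂ) with ha
  set b := (m + 1 / 2 : ℂ) with hb
  set c := (s + 1 / 2 : ℂ) with hc
  have hm : (0 : ℝ) ≤ m := m.cast_nonneg
  have hane : ∀ j : ℕ, a ≠ -(j : ℂ) := ne_neg_natCast_of_re_pos (by simp [ha]; linarith)
  have hbne : ∀ j : ℕ, b ≠ -(j : ℂ) := ne_neg_natCast_of_re_pos (by simp [hb]; linarith)
  have hcne : ∀ j : ℕ, c ≠ -(j : ℂ) := ne_neg_natCast_of_re_pos (by simp [hc]; linarith)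
  have hk : a + b = c + (2 * m : ℕ) := by
    rw [ha, hb, hc]
    push_cast
    ring
  have hd := discSummable_hypCoeff a b c
  have t1 := (hd.tendsto_one_sub_pow_mul (2 * m) (tendsto_hypCoeff_div_pow hk hane hbne hcne)).comp
    tendsto_exp_neg_two_mul
  have t2 := (hd.derivCoeff.tendsto_one_sub_pow_mul (2 * m)
    (tendsto_derivCoeff_hypCoeff hk hane hbne hcne)).comp tendsto_exp_neg_two_mul
  set κ := Complex.Gamma c / (Complex.Gamma a * Complex.Gamma b) with hκ
  have hcont : ∀ g : ℂ → ℂ, ContinuousAt g 0 → Tendsto (fun η : ℝ => g η) (𝓝[>] 0) (𝓝 (g 0)) := by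
    intro g hg
    have h : ContinuousAt (fun η : ℝ => g η) 0 :=
      ContinuousAt.comp (f := fun η : ℝ => (η : ℂ)) (by simpa using hg)
        Complex.continuous_ofReal.continuousAt
    simpa using h.tendsto.mono_left nhdsWithin_le_nhds
  obtain ⟨d1, _, d2, -⟩ := hasDerivAt_regSol m s (u := Complex.cosh 0) (by simp)
  have cc : ContinuousAt Complex.cosh 0 := Complex.continuous_cosh.continuousAt
  have c1 : ContinuousAt (fun ζ => regSol m s (Complex.cosh ζ)) 0 :=
    ContinuousAt.comp (f := Complex.cosh) d1.continuousAt cc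
  have c2 : ContinuousAt (fun ζ => regSolDeriv m s (Complex.cosh ζ)) 0 :=
    ContinuousAt.comp (f := Complex.cosh) d2.continuousAt cc
  have u1 := hcont _ c1
  have u2 := hcont (fun ζ => Complex.sinh ζ * regSolDeriv m s (Complex.cosh ζ))
    (Complex.continuous_sinh.continuousAt.mul c2)
  have u3 := hcont (fun ζ => Complex.exp ζ ^ (2 * m + 1) * Complex.exp (-a * ζ))
    (Continuous.continuousAt (by fun_prop))
  have u4 := hcont (fun ζ => Complex.exp (-2 * ζ)) (Continuous.continuousAt (by fun_prop))
  have hlim := u3.mul ((t1.mul u2).add ((((t1.const_mul a)).add ((u4.const_mul 2).mul t2)).mul u1))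
  have hreg : regSol m s (Complex.cosh 0) = 1 := by
    simp [regSol, ordinaryHypergeometric_zero]
  have hval : Complex.exp 0 ^ (2 * m + 1) * Complex.exp (-a * 0) *
      (((2 * m).factorial : ℂ) * 0 * (Complex.sinh 0 * regSolDeriv m s (Complex.cosh 0)) +
      (a * (((2 * m).factorial : ℂ) * 0) + 2 * Complex.exp (-2 * 0) *
        (((2 * m).factorial : ℂ) * κ)) * regSol m s (Complex.cosh 0)) =
      2 * (((2 * m).factorial : ℂ) * κ) := by
    rw [hreg]
    simp
  rw [hval] at hlim
  refine tendsto_nhds_unique (tendsto_const_nhds.congr' ?_) hlim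
  filter_upwards [self_mem_nhdsWithin] with η hη
  rw [sol1.wronskian_eq sol2 hξ hη]
  simp only [wronskian, recSol, recSolDeriv, two_mul_sinh_eq, mul_pow, ← ha, ← hb, ← hc,
    Function.comp, hypDeriv, ordinaryHypergeometric_eq_tsum_hypCoeff]
  push_cast
  ring

/-! ### Connection formula and expansion of the Legendre function at infinity -/

theorem ordinaryHypergeometric_comm (a b c z : ℂ) : ₂F₁ a b c z = ₂F₁ b a c z := by
  simp only [ordinaryHypergeometric, ordinaryHypergeometricSeries_symm]

/-- This is Euler's transformation in w = (u - 1)/(u + 1), for which 1 - w is the inverse of (1 +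
u)/2. -/
theorem regSol_one_sub (m : ℕ) (s : ℂ) {u : ℝ} (hu : 0 < u) :
    regSol m (1 - s) u = regSol m s u := by
  have hw := norm_sub_one_div_add_one_lt_one (u := (u : ℂ)) (by simpa using hu)
  have hc : ∀ k : ℕ, (m + 1 : ℂ) ≠ -(k : ℂ) :=
    ne_neg_natCast_of_re_pos (by simp; positivity)
  have h1 : (u : ℂ) + 1 ≠ 0 := by
    exact_mod_cast (by linarith : u + 1 ≠ 0)
  have e : 1 - ((u : ℂ) - 1) / (u + 1) = ((1 + (u : ℂ)) / 2)⁻¹ := by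
    rw [add_comm 1 (u : ℂ)]
    field_simp
    ring
  have hb : (1 + (u : ℂ)) / 2 ≠ 0 := by rw [add_comm]; simpa using h1
  have harg : ((1 + (u : ℂ)) / 2).arg ≠ Real.pi := by
    refine Complex.slitPlane_arg_ne_pi (Or.inl ?_)
    simp
    linarith
  rw [regSol, regSol, ordinaryHypergeometric_euler (m + 1 - s) (1 - s) hc hw, e,
    Complex.inv_cpow _ _ harg, ← Complex.cpow_neg, ← mul_assoc, ← Complex.cpow_add _ _ hb,
    ordinaryHypergeometric_comm]
  congr 2 <;> ring_nf

/-- The connection formula for the solution that is regular at `u = 1`. -/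
theorem regSol_cosh_eq {m : ℕ} {s : ℂ} (h0 : 0 < s.re) (h1 : s.re < 1) {ξ : ℝ} (hξ : 0 < ξ) :
    (2 * s - 1) * regSol m s (Complex.cosh ξ) =
      2 * (2 * m).factorial / Complex.Gamma (m + 1 / 2) *
        (Complex.Gamma (s + 1 / 2) / Complex.Gamma (m + s) * recSol m (1 - s) ξ -
          Complex.Gamma (1 - s + 1 / 2) / Complex.Gamma (m + (1 - s)) * recSol m s ξ) := by
  have k12 := wronskian_recSol (m := m) h0 h1 hξ
  have k1 := wronskian_recSol_regSol (m := m) h0 hξ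
  have k2 := wronskian_recSol_regSol (m := m) (s := 1 - s) (by simpa using h1) hξ
  have sol1 := (isGegenbauerSol_recSol m (s := 1 - s) (by simpa using h1))
  have hS : (2 * Complex.sinh ξ) ^ (2 * m + 1) ≠ 0 :=
    pow_ne_zero _ (mul_ne_zero two_ne_zero (sinh_ofReal_ne_zero hξ))
  have hsymm : regSol m (1 - s) (Complex.cosh ξ) = regSol m s (Complex.cosh ξ) := by
    rw [← Complex.ofReal_cosh]
    exact regSol_one_sub m s (Real.cosh_pos ξ)
  -- The symmetry is known on the positive real axis only, so derivatives are compared along it.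
  have hsymm' : regSolDeriv m (1 - s) (Complex.cosh ξ) = regSolDeriv m s (Complex.cosh ξ) := by
    rw [← Complex.ofReal_cosh]
    have e : (fun u : ℝ => regSol m (1 - s) u) =ᶠ[𝓝 (Real.cosh ξ)] fun u : ℝ => regSol m s u := by
      filter_upwards [lt_mem_nhds (Real.cosh_pos ξ)] with u hu using regSol_one_sub m s hu
    have hre : 0 < ((Real.cosh ξ : ℝ) : ℂ).re := by simpa using Real.cosh_pos ξ
    exact ((hasDerivAt_regSol m (1 - s) hre).1.comp_ofReal).unique
      ((hasDerivAt_regSol m s hre).1.comp_ofReal.congr_of_eventuallyEq e)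
  simp only [wronskian] at k12 k1 k2
  rw [hsymm, hsymm'] at k2
  rw [← k12]
  -- For any f, g, h the identity W(f,g) h = W(f,h) g - W(g,h) f holds pointwise.
  linear_combination recSol m (1 - s) ξ * k1 - recSol m s ξ * k2

/-- Euler's transformation moves the singularity at ξ = 0 into (1 - e^{-2ξ})^{-2m} and leaves the
parameter 1/2 - m, the source of the coefficients (1/2 - m)_n in the final bound. -/
theorem recSol_eq {m : ℕ} {s : ℂ} (h0 : 0 < s.re) {ξ : ℝ} (hξ : 0 < ξ) :
    recSol m s ξ = ((2 * Complex.sinh ξ) ^ (2 * m))⁻¹ * (Complex.exp ((m - s) * ξ) *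
      ₂F₁ (1 / 2 - m : ℂ) (s - m) (s + 1 / 2) (Complex.exp (-2 * ξ))) := by
  have hε := norm_exp_neg_two_mul_lt_one hξ
  have hc : ∀ k : ℕ, s + 1 / 2 ≠ -(k : ℂ) :=
    ne_neg_natCast_of_re_pos (by simp; linarith)
  have hε1 : 1 - Complex.exp (-2 * (ξ : ℂ)) ≠ 0 := by
    intro h
    rw [← sub_eq_zero.1 h, norm_one] at hε
    exact lt_irrefl _ hε
  rw [recSol, ordinaryHypergeometric_euler _ _ hc hε, two_mul_sinh_eq,
    show s + 1 / 2 - (m + s) - (m + 1 / 2 : ℂ) = -((2 * m : ℕ) : ℂ) by push_cast; ring,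
    show s + 1 / 2 - (m + s) = (1 / 2 - m : ℂ) by ring,
    show s + 1 / 2 - (m + 1 / 2 : ℂ) = s - m by ring, Complex.cpow_neg, Complex.cpow_natCast,
    mul_pow, ← Complex.exp_nat_mul, mul_inv, ← Complex.exp_neg]
  have e : Complex.exp (-(m + s) * ξ) =
      Complex.exp (-(((2 * m : ℕ) : ℂ) * ξ)) * Complex.exp ((m - s) * ξ) := by
    rw [← Complex.exp_add]
    congr 1
    push_cast
    ring
  rw [e]
  ring

theorem legendreP_cosh_eq_regSol (m : ℕ) (s : ℂ) {ξ : ℝ} (hξ : 0 < ξ) :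
    legendreP (-(m : ℂ)) (s - 1) (Real.cosh ξ) =
      (m.factorial : ℂ)⁻¹ * (Complex.sinh ξ / 2) ^ m * regSol m s (Complex.cosh ξ) := by
  have hS : 0 < Real.sinh ξ := Real.sinh_pos_iff.2 hξ
  have hC : 1 < Real.cosh ξ := Real.one_lt_cosh.2 hξ.ne'
  have hcs := Real.cosh_sq ξ
  rw [← Complex.ofReal_sinh, ← Complex.ofReal_cosh]
  generalize Real.sinh ξ = S at *
  generalize Real.cosh ξ = u at *
  have hu1 : (u : ℂ) + 1 ≠ 0 := by exact_mod_cast (by linarith : u + 1 ≠ 0)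
  have hu1' : 1 + (u : ℂ) ≠ 0 := by rwa [add_comm]
  have hSC : (S : ℂ) ≠ 0 := by exact_mod_cast hS.ne'
  -- As S² = u² - 1, the base is a square and its power -m/2 becomes an integral power.
  have hr : ((u + 1) / (u - 1) : ℝ) = ((u + 1) / S) ^ 2 := by
    rw [div_pow, div_eq_div_iff (by linarith) (by positivity)]
    linear_combination -(u + 1) * hcs
  have ht : 0 < (u + 1) / S := by positivity
  have hpow : (((u + 1) / (u - 1) : ℝ) : ℂ) ^ (-(m : ℂ) / 2) = (((u : ℂ) + 1) / S) ^ (-(m : ℤ)) := by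
    rw [hr, show (-(m : ℂ) / 2) = ((-(m : ℝ) / 2 : ℝ) : ℂ) by push_cast; ring,
      ← Complex.ofReal_cpow (by positivity), ← Real.rpow_natCast, ← Real.rpow_mul ht.le,
      show ((2 : ℕ) : ℝ) * (-(m : ℝ) / 2) = ((-(m : ℤ) : ℤ) : ℝ) by push_cast; ring,
      Real.rpow_intCast]
    push_cast
    rfl
  have hb : (1 + (u : ℂ)) / 2 ≠ 0 := div_ne_zero hu1' two_ne_zero
  have e1 : 1 - (((1 - u) / 2 : ℝ) : ℂ) = (1 + u) / 2 := by push_cast; ring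
  have e2 : (((1 - u) / 2 : ℝ) : ℂ) / ((((1 - u) / 2 : ℝ) : ℂ) - 1) = (u - 1) / (u + 1) := by
    rw [show (((1 - u) / 2 : ℝ) : ℂ) - 1 = -((u + 1) / 2) by push_cast; ring]
    push_cast
    field_simp
    ring
  have e3 : Complex.Gamma (1 - -(m : ℂ)) = m.factorial := by
    rw [sub_neg_eq_add, add_comm, Complex.Gamma_nat_eq_factorial]
  have e4 : (1 + (u : ℂ)) / 2 = ((u : ℂ) + 1) / 2 := by rw [add_comm]
  have e5 : ((1 + (u : ℂ)) / 2) ^ (-(-(s - 1))) =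
      ((1 + (u : ℂ)) / 2) ^ m * ((1 + (u : ℂ)) / 2) ^ (-(m + 1 - s)) := by
    rw [← Complex.cpow_natCast, ← Complex.cpow_add _ _ hb]
    congr 1
    ring
  rw [legendreP, gaussHypergeometric, regSol, e1, e2, e3, hpow, e5,
    ordinaryHypergeometric_comm (m + 1 - s), zpow_neg, zpow_natCast, e4,
    show 1 - -(m : ℂ) - (s - 1 + 1) = m + 1 - s by ring, show -(s - 1) = 1 - s by ring,
    show 1 - -(m : ℂ) = m + 1 by ring]
  simp only [div_pow]
  field_simp

/-- One of the two terms of the expansion of `legendreP` at infinity. -/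
noncomputable def connTerm (m : ℕ) (s : ℂ) (ξ : ℝ) : ℂ :=
  Complex.Gamma (1 / 2 - s) / Complex.Gamma (m + (1 - s)) * (Complex.exp ((m - s) * ξ) *
    ₂F₁ (1 / 2 - m : ℂ) (s - m) (s + 1 / 2) (Complex.exp (-2 * ξ)))

/-- The expansion of the Legendre function at infinity. -/
theorem legendreP_cosh_eq {m : ℕ} {s : ℂ} (h0 : 0 < s.re) (h1 : s.re < 1) (hs : s.re ≠ 1 / 2)
    {ξ : ℝ} (hξ : 0 < ξ) :
    legendreP (-(m : ℂ)) (s - 1) (Real.cosh ξ) =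
      ((√Real.pi : ℝ) : ℂ)⁻¹ * ((2 * Complex.sinh ξ) ^ m)⁻¹ *
        (connTerm m s ξ + connTerm m (1 - s) ξ) := by
  have hconn := regSol_cosh_eq (m := m) h0 h1 hξ
  have hS := sinh_ofReal_ne_zero hξ
  have hhalf : ∀ t : ℂ, t.re ≠ 1 / 2 → 1 / 2 - t ≠ 0 := by
    intro t ht h
    apply ht
    rw [← sub_eq_zero.1 h]
    norm_num
  have hs1 := hhalf s hs
  have hs2 := hhalf (1 - s) (by simp; intro h; apply hs; linarith)
  have hs3 : 2 * s - 1 ≠ 0 := by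
    intro h
    apply hs1
    linear_combination (-1 / 2 : ℂ) * h
  have g1 : Complex.Gamma (1 - s + 1 / 2) = (1 / 2 - s) * Complex.Gamma (1 / 2 - s) := by
    rw [← Complex.Gamma_add_one _ hs1]
    congr 1
    ring
  have g2 : Complex.Gamma (s + 1 / 2) = (1 / 2 - (1 - s)) * Complex.Gamma (1 / 2 - (1 - s)) := by
    rw [← Complex.Gamma_add_one _ hs2]
    congr 1
    ring
  have gm : ∀ z : ℂ, 0 < z.re → Complex.Gamma (m + z) ≠ 0 := fun z hz =>
    Complex.Gamma_ne_zero_of_re_pos (by simp; positivity)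
  have g3 := gm s h0
  have g4 := gm (1 - s) (by simpa using h1)
  have g5 := gm (1 / 2) (by norm_num)
  -- Legendre's duplication formula at m + 1/2 turns (2m)!/Γ(m + 1/2) into 4^m m!/√π.
  have dup := Complex.Gamma_mul_Gamma_add_half (m + 1 / 2 : ℂ)
  rw [show (m + 1 / 2 + 1 / 2 : ℂ) = m + 1 by ring, Complex.Gamma_nat_eq_factorial,
    show 2 * (m + 1 / 2 : ℂ) = ((2 * m : ℕ) : ℂ) + 1 by push_cast; ring,
    Complex.Gamma_nat_eq_factorial,
    show (1 : ℂ) - (((2 * m : ℕ) : ℂ) + 1) = -((2 * m : ℕ) : ℂ) by ring,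
    Complex.cpow_neg, Complex.cpow_natCast, pow_mul] at dup
  have hpi : ((√Real.pi : ℝ) : ℂ) ≠ 0 := by
    exact_mod_cast (Real.sqrt_pos.2 Real.pi_pos).ne'
  have hmf : (m.factorial : ℂ) ≠ 0 := Nat.cast_ne_zero.2 m.factorial_ne_zero
  have hfac : 2 * ((2 * m).factorial : ℂ) / Complex.Gamma (m + 1 / 2) =
      2 * m.factorial * (2 ^ 2) ^ m / ((√Real.pi : ℝ) : ℂ) := by
    rw [div_eq_div_iff g5 hpi]
    generalize Complex.Gamma (m + 1 / 2 : ℂ) = G at dup g5 ⊢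
    field_simp at dup
    linear_combination -2 * dup
  rw [hfac, recSol_eq h0 hξ, recSol_eq (s := 1 - s) (by simpa using h1) hξ, g1, g2] at hconn
  rw [legendreP_cosh_eq_regSol m s hξ, connTerm, connTerm]
  refine mul_left_cancel₀ hs3 ?_
  rw [mul_left_comm, hconn]
  rw [show (1 : ℂ) - (1 - s) = s by ring]
  generalize Complex.Gamma (m + s) = G1 at *
  generalize Complex.Gamma (m + (1 - s)) = G2 at *
  generalize Complex.Gamma (1 / 2 - s) = G3 at *
  generalize Complex.Gamma (1 / 2 - (1 - s)) = G4 at *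
  generalize ₂F₁ (1 / 2 - m : ℂ) (s - m) (s + 1 / 2) (Complex.exp (-2 * ξ)) = F1 at *
  generalize ₂F₁ (1 / 2 - m : ℂ) (1 - s - m) (1 - s + 1 / 2) (Complex.exp (-2 * ξ)) = F2 at *
  generalize Complex.exp ((m - s) * ξ) = E1 at *
  generalize Complex.exp ((m - (1 - s)) * ξ) = E2 at *
  generalize Complex.sinh ξ = S at *
  rw [show 2 * m = m + m by ring]
  simp only [mul_pow, div_pow, pow_add, ← pow_mul]
  field_simp
  ring

/-! ### Quotients of Gamma functions -/

theorem norm_le_norm_of_re_sq_le {a b : ℂ} (hre : a.re ^ 2 ≤ b.re ^ 2) (him : a.im ^ 2 = b.im ^ 2) :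
    ‖a‖ ≤ ‖b‖ := by
  rw [← sq_le_sq₀ (norm_nonneg _) (norm_nonneg _), ← Complex.normSq_eq_norm_sq,
    ← Complex.normSq_eq_norm_sq, Complex.normSq_apply, Complex.normSq_apply]
  nlinarith

/-- Since (z + 1/2)² = z(z + 1) + 1/4, the error is 1/4 relative to |z||z + 1| ≥ x(x + 1). -/
theorem norm_add_half_sq_le {z : ℂ} {x : ℝ} (hx : 0 < x) (hz : x ≤ z.re) :
    ‖z + 1 / 2‖ ^ 2 ≤ ‖z‖ * ‖z + 1‖ * (1 + 1 / (4 * x * (x + 1))) := by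
  have h1 : ‖z + 1 / 2‖ ^ 2 ≤ ‖z‖ * ‖z + 1‖ + 1 / 4 := by
    rw [← norm_pow, show (z + 1 / 2) ^ 2 = z * (z + 1) + 1 / 4 by ring, ← norm_mul]
    refine (norm_add_le _ _).trans ?_
    norm_num
  have h2 : x ≤ ‖z‖ := hz.trans (Complex.re_le_norm z)
  have h3 : x + 1 ≤ ‖z + 1‖ := by
    refine le_trans ?_ (Complex.re_le_norm (z + 1))
    simp
    linarith
  have h4 : x * (x + 1) ≤ ‖z‖ * ‖z + 1‖ := mul_le_mul h2 h3 (by linarith) (norm_nonneg _)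
  have h5 : 1 / 4 ≤ ‖z‖ * ‖z + 1‖ * (1 / (4 * x * (x + 1))) := by
    rw [mul_one_div, le_div_iff₀ (by positivity)]
    linarith
  linarith

/-- Multiply the preceding bound over z = s + j. The products |s + j||s + j + 1| telescope, and so
do the errors 1/(4x(x+1)) = 1/(4x) - 1/(4(x+1)) once 1 + t ≤ e^t is used. The factor j = 0, large
for small σ, is kept unexponentiated. -/
theorem norm_mul_prod_add_half_le {s : ℂ} {σ : ℝ} (hσ : 0 < σ) (hs : s.re = σ) (n : ℕ) :
    ‖s‖ * ∏ j ∈ Finset.range (n + 1), ‖s + 1 / 2 + j‖ ^ 2 ≤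
      (1 + 1 / (4 * σ * (σ + 1))) * Real.exp (1 / (4 * (σ + 1)) - 1 / (4 * (σ + n + 1))) *
        ‖s + n + 1‖ * ∏ j ∈ Finset.range (n + 1), ‖s + j‖ ^ 2 := by
  induction n with
  | zero =>
    have h := norm_add_half_sq_le hσ hs.ge
    simp only [zero_add, Finset.range_one, Finset.prod_singleton, Nat.cast_zero, add_zero,
      sub_self, Real.exp_zero, mul_one]
    nlinarith [norm_nonneg s]
  | succ n ih =>
    rw [Finset.prod_range_succ _ (n + 1), Finset.prod_range_succ (fun j : ℕ => ‖s + j‖ ^ 2) (n + 1)]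
    have hn : (0 : ℝ) ≤ n := n.cast_nonneg
    have hx : 0 < σ + n + 1 := by positivity
    have h := norm_add_half_sq_le (z := s + (n + 1 : ℕ)) hx (by simp [hs]; linarith)
    have h2 : 1 + 1 / (4 * (σ + n + 1) * (σ + n + 1 + 1)) ≤
        Real.exp (1 / (4 * (σ + n + 1)) - 1 / (4 * (σ + n + 1 + 1))) := by
      have e : 1 / (4 * (σ + n + 1) * (σ + n + 1 + 1)) =
          1 / (4 * (σ + n + 1)) - 1 / (4 * (σ + n + 1 + 1)) := by field_simp; ring
      rw [e, add_comm]
      exact Real.add_one_le_exp _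
    have e1 : s + 1 / 2 + ((n + 1 : ℕ) : ℂ) = s + (n + 1 : ℕ) + 1 / 2 := by ring
    have e2 : s + n + 1 = s + ((n + 1 : ℕ) : ℂ) := by push_cast; ring
    have e3 : 1 / (4 * (σ + 1)) - 1 / (4 * (σ + ((n + 1 : ℕ) : ℝ) + 1)) =
        (1 / (4 * (σ + 1)) - 1 / (4 * (σ + n + 1))) +
          (1 / (4 * (σ + n + 1)) - 1 / (4 * (σ + n + 1 + 1))) := by push_cast; ring
    rw [e1, e3, Real.exp_add]
    rw [e2] at ih
    set z := s + ((n + 1 : ℕ) : ℂ) with hz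
    calc ‖s‖ * ((∏ j ∈ Finset.range (n + 1), ‖s + 1 / 2 + j‖ ^ 2) * ‖z + 1 / 2‖ ^ 2)
        = (‖s‖ * ∏ j ∈ Finset.range (n + 1), ‖s + 1 / 2 + j‖ ^ 2) * ‖z + 1 / 2‖ ^ 2 := by ring
      _ ≤ ((1 + 1 / (4 * σ * (σ + 1))) * Real.exp (1 / (4 * (σ + 1)) - 1 / (4 * (σ + n + 1))) *
            ‖z‖ * ∏ j ∈ Finset.range (n + 1), ‖s + j‖ ^ 2) *
          (‖z‖ * ‖z + 1‖ * Real.exp (1 / (4 * (σ + n + 1)) - 1 / (4 * (σ + n + 1 + 1)))) := by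
          refine mul_le_mul ih (h.trans ?_) (by positivity) (by positivity)
          gcongr
      _ = _ := by ring

theorem one_add_mul_exp_le {σ : ℝ} (hσ : 0 < σ) :
    (1 + 1 / (4 * σ * (σ + 1))) * Real.exp (1 / (4 * (σ + 1))) ≤
      Real.exp (1 + 1 / (12 * σ * (1 / 2 + σ))) := by
  set y := 1 / (4 * σ * (σ + 1)) with hy
  have h1 : y / 3 ≤ 1 / (12 * σ * (1 / 2 + σ)) := by
    rw [hy, div_div]
    refine one_div_le_one_div_of_le (by positivity) ?_
    nlinarith
  have h2 : 1 / (4 * (σ + 1)) ≤ 1 / 4 := one_div_le_one_div_of_le (by norm_num) (by linarith)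
  -- Tangent line at y = 2: the exponent is 17/12 + (y/3 - 2/3), e^{17/12} ≥ 3, and 3(1 + y/3 - 2/3)
  -- = 1 + y. The remaining 1/4 of the exponent absorbs 1/(4(σ+1)).
  have h3 : 1 + y ≤ Real.exp (3 / 4 + y / 3) := by
    have a1 := Real.add_one_le_exp (y / 3 - 2 / 3)
    have a2 := Real.quadratic_le_exp_of_nonneg (show (0 : ℝ) ≤ 17 / 12 by norm_num)
    have a3 : Real.exp (3 / 4 + y / 3) = Real.exp (17 / 12) * Real.exp (y / 3 - 2 / 3) := by
      rw [← Real.exp_add]; ring_nf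
    rw [a3]
    have a4 : 3 ≤ Real.exp (17 / 12) := by norm_num at a2 ⊢; linarith
    nlinarith [Real.exp_pos (y / 3 - 2 / 3)]
  calc (1 + y) * Real.exp (1 / (4 * (σ + 1))) ≤ Real.exp (3 / 4 + y / 3) * Real.exp (1 / 4) := by
        gcongr
    _ = Real.exp (1 + y / 3) := by rw [← Real.exp_add]; ring_nf
    _ ≤ _ := by gcongr

/-- An explicit bound for the quotient of Gamma functions with arguments differing by `1 / 2`. -/
theorem norm_mul_Gamma_div_Gamma_sq_le {s : ℂ} {σ : ℝ} (hσ : 0 < σ) (hs : s.re = σ) :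
    ‖s‖ * ‖Complex.Gamma s / Complex.Gamma (s + 1 / 2)‖ ^ 2 ≤
      Real.exp (1 + 1 / (12 * σ * (1 / 2 + σ))) := by
  have hG : Complex.Gamma (s + 1 / 2) ≠ 0 :=
    Complex.Gamma_ne_zero_of_re_pos (by simp [hs]; positivity)
  -- In Gauss's product the n-th approximation of the left side is |s| ∏|s+1/2+j|² / (n ∏|s+j|²), at
  -- most B(n + |s+1|)/n.
  have h1 := (((Complex.GammaSeq_tendsto_Gamma s).div
    (Complex.GammaSeq_tendsto_Gamma (s + 1 / 2)) hG).norm.pow 2).const_mul ‖s‖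
  set B := (1 + 1 / (4 * σ * (σ + 1))) * Real.exp (1 / (4 * (σ + 1))) with hB
  have h2 : Tendsto (fun n : ℕ => B * (1 + ‖s + 1‖ / n)) atTop (𝓝 (B * (1 + 0))) :=
    (tendsto_const_nhds.add (tendsto_const_div_atTop_nhds_zero_nat _)).const_mul B
  rw [add_zero, mul_one] at h2
  refine (le_of_tendsto_of_tendsto h1 h2 ?_).trans (one_add_mul_exp_le hσ)
  filter_upwards [eventually_ge_atTop 1] with n hn
  have hnpos : (0 : ℝ) < n := by exact_mod_cast hn
  have hn0 : (n : ℂ) ≠ 0 := Nat.cast_ne_zero.2 (by omega)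
  have hpos : ∀ z : ℂ, 0 < z.re → ∀ j : ℕ, 0 < ‖z + j‖ := by
    intro z hz j
    refine norm_pos_iff.2 fun h => ?_
    have := congrArg Complex.re h
    simp at this
    have : (0 : ℝ) ≤ j := j.cast_nonneg
    linarith
  have hP1 : 0 < ∏ j ∈ Finset.range (n + 1), ‖s + j‖ :=
    Finset.prod_pos fun j _ => hpos s (by rw [hs]; exact hσ) j
  have hP2 : 0 < ∏ j ∈ Finset.range (n + 1), ‖s + 1 / 2 + j‖ :=
    Finset.prod_pos fun j _ => hpos (s + 1 / 2) (by simp [hs]; positivity) j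
  have h3 := norm_mul_prod_add_half_le hσ hs n
  rw [Finset.prod_pow, Finset.prod_pow] at h3
  have hnf : (0 : ℝ) < n.factorial := by exact_mod_cast n.factorial_pos
  have e1 : ‖((n : ℂ) ^ s : ℂ)‖ = (n : ℝ) ^ σ := by
    rw [Complex.norm_natCast_cpow_of_pos (by omega), hs]
  have e2 : ‖((n : ℂ) ^ (s + 1 / 2) : ℂ)‖ = (n : ℝ) ^ σ * (n : ℝ) ^ (1 / 2 : ℝ) := by
    rw [Complex.norm_natCast_cpow_of_pos (by omega), ← Real.rpow_add hnpos]
    simp [hs]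
  have e3 : ((n : ℝ) ^ (1 / 2 : ℝ)) ^ 2 = n := by
    rw [← Real.rpow_natCast, ← Real.rpow_mul hnpos.le]
    norm_num
  have hσn : 0 < (n : ℝ) ^ σ := by positivity
  have hhn : 0 < (n : ℝ) ^ (1 / 2 : ℝ) := by positivity
  have h4 : Real.exp (1 / (4 * (σ + 1)) - 1 / (4 * (σ + n + 1))) ≤ Real.exp (1 / (4 * (σ + 1))) := by
    have : 0 < 1 / (4 * (σ + n + 1)) := by positivity
    gcongr
    linarith
  have h5 : ‖s + n + 1‖ ≤ n + ‖s + 1‖ := by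
    rw [show s + n + 1 = n + (s + 1) by ring]
    refine (norm_add_le _ _).trans (by simp)
  simp only [Pi.div_apply, Complex.GammaSeq, norm_div, norm_mul, Complex.norm_natCast, e1, e2,
    norm_prod]
  generalize ∏ j ∈ Finset.range (n + 1), ‖s + j‖ = P1 at *
  generalize ∏ j ∈ Finset.range (n + 1), ‖s + 1 / 2 + j‖ = P2 at *
  have e4 : ‖s‖ * ((n : ℝ) ^ σ * n.factorial / P1 /
      ((n : ℝ) ^ σ * (n : ℝ) ^ (1 / 2 : ℝ) * n.factorial / P2)) ^ 2 =
      ‖s‖ * P2 ^ 2 / (n * P1 ^ 2) := by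
    generalize (n : ℝ) ^ (1 / 2 : ℝ) = h at e3 hhn ⊢
    generalize (n : ℝ) ^ σ = t at hσn ⊢
    rw [← e3]
    field_simp
  rw [e4, div_le_iff₀ (by positivity)]
  refine h3.trans ?_
  calc _ ≤ (1 + 1 / (4 * σ * (σ + 1))) * Real.exp (1 / (4 * (σ + 1))) * (n + ‖s + 1‖) * P1 ^ 2 := by
        gcongr
    _ = _ := by
        rw [hB]
        field_simp

/-- For z = a + ib, |sin z|² = sin² a + sinh² b and |cos z|² = cos² a + sinh² b; the sinh² term is
what requires T ≥ 1. -/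
theorem norm_sin_le_mul_norm_cos {T a : ℝ} (hT : 1 ≤ T) (h : Real.sin a ^ 2 ≤ T ^ 2 * Real.cos a ^ 2)
    {z : ℂ} (hz : z.re = a) : ‖Complex.sin z‖ ≤ T * ‖Complex.cos z‖ := by
  have hT2 : 1 ≤ T ^ 2 := one_le_pow₀ hT
  rw [← sq_le_sq₀ (norm_nonneg _) (by positivity), mul_pow, ← Complex.normSq_eq_norm_sq,
    ← Complex.normSq_eq_norm_sq, Complex.normSq_apply, Complex.normSq_apply]
  rw [← Complex.re_add_im z, hz, Complex.sin_add_mul_I, Complex.cos_add_mul_I]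
  simp
  simp only [Complex.sin_ofReal_re, Complex.cos_ofReal_re, Complex.sinh_ofReal_re]
  have h1 := Real.cosh_sq z.im
  have h2 := Real.sin_sq_add_cos_sq a
  have e1 : Real.sin a * Real.cosh z.im * (Real.sin a * Real.cosh z.im) +
      Real.cos a * Real.sinh z.im * (Real.cos a * Real.sinh z.im) =
      Real.sin a ^ 2 + Real.sinh z.im ^ 2 := by
    linear_combination Real.sin a ^ 2 * h1 + Real.sinh z.im ^ 2 * h2
  have e2 : Real.cos a * Real.cosh z.im * (Real.cos a * Real.cosh z.im) +
      Real.sin a * Real.sinh z.im * (Real.sin a * Real.sinh z.im) =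
      Real.cos a ^ 2 + Real.sinh z.im ^ 2 := by
    linear_combination Real.cos a ^ 2 * h1 + Real.sinh z.im ^ 2 * h2
  rw [e1, e2]
  nlinarith [sq_nonneg (Real.sinh z.im)]

theorem norm_sin_pi_le {σ : ℝ} (hσ0 : 0 < σ) (hσ : σ < 1 / 2) {s : ℂ}
    (hs : s.re = σ ∨ s.re = 1 - σ) :
    ‖Complex.sin (Real.pi * s)‖ ≤ max 1 (Real.tan (Real.pi * σ)) * ‖Complex.cos (Real.pi * s)‖ := by
  have hc : 0 < Real.cos (Real.pi * σ) := by
    apply Real.cos_pos_of_mem_Ioo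
    constructor <;> nlinarith [Real.pi_pos]
  have ht : Real.sin (Real.pi * σ) ^ 2 ≤
      max 1 (Real.tan (Real.pi * σ)) ^ 2 * Real.cos (Real.pi * σ) ^ 2 := by
    have h0 : Real.sin (Real.pi * σ) = Real.tan (Real.pi * σ) * Real.cos (Real.pi * σ) :=
      (Real.tan_mul_cos hc.ne').symm
    have hs0 : 0 ≤ Real.sin (Real.pi * σ) :=
      Real.sin_nonneg_of_nonneg_of_le_pi (by positivity) (by nlinarith [Real.pi_pos])
    rw [← mul_pow]
    refine pow_le_pow_left₀ hs0 ?_ 2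
    conv_lhs => rw [h0]
    gcongr
    exact le_max_right _ _
  refine norm_sin_le_mul_norm_cos (a := Real.pi * s.re) (le_max_left _ _) ?_ (by simp)
  rcases hs with hs | hs
  · rw [hs]; exact ht
  · rw [hs, mul_sub, mul_one, Real.sin_pi_sub, Real.cos_pi_sub, neg_sq]
    exact ht

/-- The reflection formula at s and at s + 1/2 shows that the two quotients differ by the factor
tan(πs). -/
theorem norm_Gamma_half_sub_div_le {σ : ℝ} (hσ0 : 0 < σ) (hσ : σ < 1 / 2) {s : ℂ}
    (hs : s.re = σ ∨ s.re = 1 - σ) :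
    ‖Complex.Gamma (1 / 2 - s) / Complex.Gamma (1 - s)‖ ≤
      max 1 (Real.tan (Real.pi * σ)) * ‖Complex.Gamma s / Complex.Gamma (s + 1 / 2)‖ := by
  have hT := norm_sin_pi_le hσ0 hσ hs
  have hre0 : 0 < s.re := by rcases hs with h | h <;> rw [h] <;> linarith
  have hre1 : s.re < 1 := by rcases hs with h | h <;> rw [h] <;> linarith
  have g1 := Complex.Gamma_mul_Gamma_one_sub s
  have g2 := Complex.Gamma_mul_Gamma_one_sub (s + 1 / 2)
  rw [show 1 - (s + 1 / 2) = 1 / 2 - s by ring,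
    show Real.pi * (s + 1 / 2) = Real.pi * s + Real.pi / 2 by ring, Complex.sin_add_pi_div_two] at g2
  have n1 : Complex.Gamma s ≠ 0 := Complex.Gamma_ne_zero_of_re_pos hre0
  have n2 : Complex.Gamma (1 - s) ≠ 0 := Complex.Gamma_ne_zero_of_re_pos (by simpa using hre1)
  have n3 : Complex.Gamma (s + 1 / 2) ≠ 0 := Complex.Gamma_ne_zero_of_re_pos (by simp; linarith)
  have hpi : (Real.pi : ℂ) ≠ 0 := by exact_mod_cast Real.pi_ne_zero
  have hsin : Complex.sin (Real.pi * s) ≠ 0 := by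
    intro h
    rw [h, div_zero] at g1
    exact mul_ne_zero n1 n2 g1
  have hcos : Complex.cos (Real.pi * s) ≠ 0 := by
    intro h
    rw [h, norm_zero, mul_zero] at hT
    exact hsin (norm_le_zero_iff.1 hT)
  have e : Complex.Gamma (1 / 2 - s) / Complex.Gamma (1 - s) =
      Complex.sin (Real.pi * s) / Complex.cos (Real.pi * s) *
        (Complex.Gamma s / Complex.Gamma (s + 1 / 2)) := by
    rw [eq_div_iff hsin] at g1
    rw [eq_div_iff hcos] at g2
    generalize Complex.Gamma (s + 1 / 2) = G1 at *
    generalize Complex.Gamma (1 / 2 - s) = G2 at *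
    generalize Complex.sin (Real.pi * s) = S at *
    generalize Complex.cos (Real.pi * s) = C at *
    field_simp
    linear_combination g2 - g1
  rw [e, norm_mul]
  gcongr
  rw [norm_div, div_le_iff₀ (norm_pos_iff.2 hcos)]
  exact hT

/-! ### Uniform coefficient bounds and the estimate on the boundary lines -/

theorem norm_ascPochhammer_sub_natCast (s : ℂ) (j : ℕ) :
    ‖(ascPochhammer ℂ j).eval (s - j)‖ = ‖(ascPochhammer ℂ j).eval (1 - s)‖ := by
  induction j with
  | zero => simp
  | succ j ih =>
    rw [ascPochhammer_succ_eval_left, ascPochhammer_succ_eval, norm_mul, norm_mul,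
      show s - ((j + 1 : ℕ) : ℂ) + 1 = s - j by push_cast; ring, ih, mul_comm,
      show s - ((j + 1 : ℕ) : ℂ) = -(1 - s + j) by push_cast; ring, norm_neg]

theorem ascPochhammer_eval_split (x : ℂ) (n k : ℕ) :
    (ascPochhammer ℂ (n + k)).eval x =
      (ascPochhammer ℂ n).eval x * (ascPochhammer ℂ k).eval (x + n) := by
  have := congrArg (Polynomial.eval x) (ascPochhammer_mul ℂ n k)
  simpa using this.symm

theorem mul_pow_le_norm_ascPochhammer {z : ℂ} {p M : ℝ} (hM : 0 ≤ M) (h0 : p ≤ ‖z‖)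
    (h1 : ∀ k : ℕ, M ≤ ‖z + (k + 1 : ℕ)‖) (n : ℕ) :
    p * M ^ n ≤ ‖(ascPochhammer ℂ (n + 1)).eval z‖ := by
  induction n with
  | zero => simpa using h0
  | succ n ih =>
    rw [ascPochhammer_succ_eval, norm_mul, pow_succ, ← mul_assoc]
    exact mul_le_mul ih (h1 n) hM (norm_nonneg _)

/-- With M = max(|s|, |1 - s|), the first factors of the two Pochhammer products are at least |1 -
s| and |s|, and all later ones at least M. The 2l factors together dominate |s|^l |1 - s|^l however
they are split. -/
theorem norm_mul_pow_le_of_add_eq {s : ℂ} (h0 : 0 < s.re) (h1 : s.re < 1) {j n l : ℕ}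
    (h : j + n = 2 * l) :
    ‖s * (1 - s)‖ ^ l ≤
      ‖(ascPochhammer ℂ j).eval (1 - s)‖ * ‖(ascPochhammer ℂ n).eval (s + 1 / 2)‖ := by
  set M := max ‖s‖ ‖1 - s‖ with hM
  have hM0 : 0 ≤ M := (norm_nonneg s).trans (le_max_left _ _)
  have hp := norm_nonneg s
  have hq := norm_nonneg (1 - s)
  have hpM : ‖s‖ ≤ M := le_max_left _ _
  have hqM : ‖1 - s‖ ≤ M := le_max_right _ _
  have b1 : ∀ j : ℕ, ‖1 - s‖ * M ^ j ≤ ‖(ascPochhammer ℂ (j + 1)).eval (1 - s)‖ := by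
    refine mul_pow_le_norm_ascPochhammer hM0 le_rfl fun k => ?_
    have hk : (0 : ℝ) ≤ k := k.cast_nonneg
    refine max_le ?_ ?_ <;> refine norm_le_norm_of_re_sq_le ?_ (by simp) <;> simp <;> nlinarith
  have b2 : ∀ n : ℕ, ‖s‖ * M ^ n ≤ ‖(ascPochhammer ℂ (n + 1)).eval (s + 1 / 2)‖ := by
    refine mul_pow_le_norm_ascPochhammer hM0 ?_ fun k => ?_
    · refine norm_le_norm_of_re_sq_le ?_ (by simp)
      simp
      nlinarith
    · have hk : (0 : ℝ) ≤ k := k.cast_nonneg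
      refine max_le ?_ ?_ <;> refine norm_le_norm_of_re_sq_le ?_ (by simp) <;> simp <;> nlinarith
  have hpq : ‖s‖ * ‖1 - s‖ ≤ M * M := mul_le_mul hpM hqM hq hM0
  rw [norm_mul]
  rcases l with _ | l
  · obtain ⟨rfl, rfl⟩ : j = 0 ∧ n = 0 := by omega
    simp
  have hl : (‖s‖ * ‖1 - s‖) ^ l ≤ (M * M) ^ l := pow_le_pow_left₀ (by positivity) hpq l
  rcases j with _ | j
  · obtain rfl : n = 2 * l + 1 + 1 := by omega
    calc (‖s‖ * ‖1 - s‖) ^ (l + 1) = (‖s‖ * ‖1 - s‖) ^ l * (‖s‖ * ‖1 - s‖) := pow_succ _ _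
      _ ≤ (M * M) ^ l * (‖s‖ * M) := by gcongr
      _ = ‖s‖ * M ^ (2 * l + 1) := by rw [← pow_two, ← pow_mul]; ring
      _ ≤ _ := by simpa using b2 (2 * l + 1)
  rcases n with _ | n
  · obtain rfl : j = 2 * l + 1 := by omega
    calc (‖s‖ * ‖1 - s‖) ^ (l + 1) = (‖s‖ * ‖1 - s‖) ^ l * (‖s‖ * ‖1 - s‖) := pow_succ _ _
      _ ≤ (M * M) ^ l * (M * ‖1 - s‖) := by gcongr
      _ = ‖1 - s‖ * M ^ (2 * l + 1) := by rw [← pow_two, ← pow_mul]; ring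
      _ ≤ _ := by simpa using b1 (2 * l + 1)
  · have hjn : j + n = 2 * l := by omega
    calc (‖s‖ * ‖1 - s‖) ^ (l + 1) = (‖s‖ * ‖1 - s‖) ^ l * (‖s‖ * ‖1 - s‖) := pow_succ _ _
      _ ≤ (M * M) ^ l * (‖s‖ * ‖1 - s‖) := by gcongr
      _ = (‖1 - s‖ * M ^ j) * (‖s‖ * M ^ n) := by
          rw [← pow_two, ← pow_mul, ← hjn, pow_add]; ring
      _ ≤ _ := mul_le_mul (b1 j) (b2 n) (by positivity) (norm_nonneg _)

theorem norm_ascPochhammer_le_of_re {s t : ℂ} (h0 : 0 ≤ s.re) (h1 : s.re ≤ t.re)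
    (him : s.im = t.im) (n : ℕ) :
    ‖(ascPochhammer ℂ n).eval s‖ ≤ ‖(ascPochhammer ℂ n).eval t‖ := by
  induction n with
  | zero => simp
  | succ n ih =>
    rw [ascPochhammer_succ_eval, ascPochhammer_succ_eval, norm_mul, norm_mul]
    refine mul_le_mul ih (norm_le_norm_of_re_sq_le ?_ (by simp [him])) (norm_nonneg _)
      (norm_nonneg _)
    have hn : (0 : ℝ) ≤ n := n.cast_nonneg
    simp
    nlinarith

/-- Up to sign (1-s)_{2l} is (s-2l)_{2l}, which shares its leading factors with (s-2l)_n. If n ≤ 2l,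
cancelling them leaves `norm_mul_pow_le_of_add_eq`; if n ≥ 2l, the excess factors of (s-2l)_n lie
below those of (s+1/2)_n one by one. -/
theorem norm_ascPochhammer_mul_pow_le {s : ℂ} (h0 : 0 < s.re) (h1 : s.re < 1) (l n : ℕ) :
    ‖(ascPochhammer ℂ n).eval (s - (2 * l : ℕ))‖ * ‖s * (1 - s)‖ ^ l ≤
      ‖(ascPochhammer ℂ (2 * l)).eval (1 - s)‖ * ‖(ascPochhammer ℂ n).eval (s + 1 / 2)‖ := by
  rw [← norm_ascPochhammer_sub_natCast s (2 * l)]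
  rcases le_total n (2 * l) with h | h
  · obtain ⟨k, hk⟩ := Nat.exists_eq_add_of_le h
    have key := norm_mul_pow_le_of_add_eq h0 h1 (j := k) (n := n) (l := l) (by omega)
    generalize ‖s * (1 - s)‖ ^ l = N at *
    rw [hk, ascPochhammer_eval_split _ n k, norm_mul,
      show s - ((n + k : ℕ) : ℂ) + n = s - k by push_cast; ring, norm_ascPochhammer_sub_natCast,
      mul_assoc]
    exact mul_le_mul_of_nonneg_left key (norm_nonneg _)
  · obtain ⟨k, rfl⟩ := Nat.exists_eq_add_of_le h
    have key := norm_mul_pow_le_of_add_eq h0 h1 (j := 0) (n := 2 * l) (l := l) (by omega)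
    generalize ‖s * (1 - s)‖ ^ l = N at *
    rw [ascPochhammer_eval_split _ (2 * l) k, ascPochhammer_eval_split _ (2 * l) k, norm_mul,
      norm_mul, sub_add_cancel, mul_assoc]
    refine mul_le_mul_of_nonneg_left ?_ (norm_nonneg _)
    rw [mul_comm]
    refine mul_le_mul ?_ ?_ (norm_nonneg _) (norm_nonneg _)
    · simpa using key
    · refine norm_ascPochhammer_le_of_re h0.le ?_ (by simp) k
      have : (0 : ℝ) ≤ l := l.cast_nonneg
      simp
      linarith

theorem Gamma_natCast_add (m : ℕ) {z : ℂ} (hz : 0 < z.re) :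
    Complex.Gamma (m + z) = (ascPochhammer ℂ m).eval z * Complex.Gamma z := by
  induction m with
  | zero => simp
  | succ m ih =>
    have h : (m : ℂ) + z ≠ 0 := by
      intro h
      have := congrArg Complex.re h
      simp at this
      have : (0 : ℝ) ≤ m := m.cast_nonneg
      linarith
    rw [show ((m + 1 : ℕ) : ℂ) + z = m + z + 1 by push_cast; ring, Complex.Gamma_add_one _ h, ih,
      ascPochhammer_succ_eval]
    ring

/-- The absolute values of the coefficients of the binomial series. -/
noncomputable def absBinomCoeff (m n : ℕ) : ℝ :=
  |(ascPochhammer ℝ n).eval (1 / 2 - (m : ℝ))| / (n.factorial : ℝ)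

theorem ascPochhammer_eval_ofReal (n : ℕ) (x : ℝ) :
    (ascPochhammer ℂ n).eval (x : ℂ) = (((ascPochhammer ℝ n).eval x : ℝ) : ℂ) := by
  induction n with
  | zero => simp
  | succ n ih => rw [ascPochhammer_succ_eval, ascPochhammer_succ_eval, ih]; push_cast; rfl

theorem norm_ascPochhammer_half_sub (m n : ℕ) :
    ‖(ascPochhammer ℂ n).eval (1 / 2 - m : ℂ)‖ = |(ascPochhammer ℝ n).eval (1 / 2 - (m : ℝ))| := by
  rw [show (1 / 2 - m : ℂ) = ((1 / 2 - (m : ℝ) : ℝ) : ℂ) by push_cast; ring,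
    ascPochhammer_eval_ofReal, Complex.norm_real, Real.norm_eq_abs]

theorem summable_absBinomCoeff (m : ℕ) {r : ℝ} (hr0 : 0 ≤ r) (hr : r < 1) :
    Summable fun n => absBinomCoeff m n * r ^ n := by
  refine Summable.of_nonneg_of_le (fun n => ?_) (fun n => ?_)
    (hasSum_ascPochhammer_mul_pow_real ‖(1 / 2 - m : ℂ)‖ hr0 hr).summable
  · rw [absBinomCoeff]; positivity
  · rw [absBinomCoeff, ← norm_ascPochhammer_half_sub]
    have := norm_ascPochhammer_eval_le n (le_refl ‖(1 / 2 - m : ℂ)‖)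
    gcongr

/-- The factor (1-s)_{2l} of Γ(2l + 1 - s) in the denominator cancels the one in the uniform
coefficient bound. -/
theorem norm_connTerm_le (l : ℕ) {s : ℂ} (h0 : 0 < s.re) (h1 : s.re < 1) {ξ : ℝ} (hξ : 0 < ξ) :
    ‖connTerm (2 * l) s ξ‖ * ‖s * (1 - s)‖ ^ l ≤
      ‖Complex.Gamma (1 / 2 - s) / Complex.Gamma (1 - s)‖ *
        (Real.exp (((2 * l : ℕ) - s.re) * ξ) *
          ∑' n, absBinomCoeff (2 * l) n * Real.exp (-2 * ξ) ^ n) := by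
  have hε := norm_exp_neg_two_mul_lt_one hξ
  have hεr : Real.exp (-2 * ξ) < 1 := by
    rw [Real.exp_lt_one_iff]; linarith
  have hεn : ‖Complex.exp (-2 * (ξ : ℂ))‖ = Real.exp (-2 * ξ) := by
    rw [Complex.norm_exp]; simp
  set N := ‖s * (1 - s)‖ ^ l with hN
  set A := ‖(ascPochhammer ℂ (2 * l)).eval (1 - s)‖ with hA
  have hA0 : 0 < A := norm_pos_iff.2
    (ascPochhammer_eval_ne_zero (ne_neg_natCast_of_re_pos (by simpa using h1)) _)
  have hsum := summable_absBinomCoeff (2 * l) (Real.exp_pos _).le hεr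
  have hF : ‖₂F₁ (1 / 2 - (2 * l : ℕ) : ℂ) (s - (2 * l : ℕ)) (s + 1 / 2)
      (Complex.exp (-2 * (ξ : ℂ)))‖ * N ≤
      A * ∑' n, absBinomCoeff (2 * l) n * Real.exp (-2 * ξ) ^ n := by
    rw [ordinaryHypergeometric_eq_tsum_hypCoeff, ← Real.norm_of_nonneg (by positivity : 0 ≤ N),
      ← Complex.norm_real, ← norm_mul, ← tsum_mul_right]
    refine tsum_of_norm_bounded (hsum.hasSum.mul_left A) fun n => ?_
    have hc0 : 0 < ‖(ascPochhammer ℂ n).eval (s + 1 / 2)‖ := norm_pos_iff.2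
      (ascPochhammer_eval_ne_zero (ne_neg_natCast_of_re_pos (by simp; linarith)) _)
    have key := norm_ascPochhammer_mul_pow_le h0 h1 l n
    rw [hypCoeff, ordinaryHypergeometricCoefficient, absBinomCoeff, ← norm_ascPochhammer_half_sub]
    rw [norm_mul, norm_mul, norm_mul, norm_mul, norm_mul, norm_inv, norm_inv, norm_pow, hεn,
      Complex.norm_natCast, Complex.norm_real, Real.norm_of_nonneg (by positivity : 0 ≤ N)]
    have hnf : (0 : ℝ) < n.factorial := by exact_mod_cast n.factorial_pos
    rw [← hN, ← hA] at key
    generalize ‖(ascPochhammer ℂ n).eval (s - (2 * l : ℕ))‖ = p1 at *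
    generalize ‖(ascPochhammer ℂ n).eval (s + 1 / 2)‖ = p2 at *
    have hb0 := norm_nonneg ((ascPochhammer ℂ n).eval (1 / 2 - (2 * l : ℕ) : ℂ))
    generalize ‖(ascPochhammer ℂ n).eval (1 / 2 - (2 * l : ℕ) : ℂ)‖ = p3 at *
    have he : 0 < Real.exp (-2 * ξ) ^ n := by positivity
    generalize Real.exp (-2 * ξ) ^ n = e at *
    have : p1 * p2⁻¹ * N ≤ A := by
      rw [mul_right_comm, mul_inv_le_iff₀ hc0]
      exact key
    calc (n.factorial : ℝ)⁻¹ * p3 * p1 * p2⁻¹ * e * N =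
        (p1 * p2⁻¹ * N) * (p3 / n.factorial * e) := by ring
      _ ≤ A * (p3 / n.factorial * e) := by gcongr
  have hexp : ‖Complex.exp (((2 * l : ℕ) - s) * (ξ : ℂ))‖ =
      Real.exp (((2 * l : ℕ) - s.re) * ξ) := by
    rw [Complex.norm_exp]; simp
  rw [connTerm, norm_mul, norm_mul, hexp, Gamma_natCast_add _ (by simpa using h1), norm_div,
    norm_div, norm_mul, ← hA]
  generalize ‖₂F₁ (1 / 2 - (2 * l : ℕ) : ℂ) (s - (2 * l : ℕ)) (s + 1 / 2)
      (Complex.exp (-2 * (ξ : ℂ)))‖ = F at *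
  generalize ∑' n, absBinomCoeff (2 * l) n * Real.exp (-2 * ξ) ^ n = D at *
  have hG : 0 < ‖Complex.Gamma (1 - s)‖ := norm_pos_iff.2
    (Complex.Gamma_ne_zero_of_re_pos (by simpa using h1))
  calc ‖Complex.Gamma (1 / 2 - s)‖ / (A * ‖Complex.Gamma (1 - s)‖) *
      (Real.exp (((2 * l : ℕ) - s.re) * ξ) * F) * N =
      ‖Complex.Gamma (1 / 2 - s)‖ / ‖Complex.Gamma (1 - s)‖ *
        (Real.exp (((2 * l : ℕ) - s.re) * ξ) * (F * N / A)) := by field_simp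
    _ ≤ _ := by
      gcongr
      rw [div_le_iff₀ hA0, mul_comm D]
      exact hF

theorem norm_Gamma_div_Gamma_le {σ : ℝ} (hσ0 : 0 < σ) (hσ : σ < 1 / 2) {s : ℂ}
    (hs : s.re = σ ∨ s.re = 1 - σ) :
    ‖Complex.Gamma s / Complex.Gamma (s + 1 / 2)‖ ≤ ‖s * (1 - s)‖ ^ (-(1 / 4) : ℝ) *
      ((σ⁻¹ - 1) ^ (1 / 4 : ℝ) * Real.exp (1 / 2 + 1 / (24 * s.re * (1 / 2 + s.re)))) := by
  have hre0 : 0 < s.re := by rcases hs with h | h <;> rw [h] <;> linarith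
  have hre1 : s.re < 1 := by rcases hs with h | h <;> rw [h] <;> linarith
  have h := norm_mul_Gamma_div_Gamma_sq_le hre0 rfl
  have hp : 0 < ‖s‖ := hre0.trans_le (Complex.re_le_norm s)
  have hq : 0 < ‖1 - s‖ := lt_of_lt_of_le (by simpa using hre1) (Complex.re_le_norm (1 - s))
  have hσ1 : 0 < σ⁻¹ - 1 := by
    rw [sub_pos, one_lt_inv₀ hσ0]
    linarith
  -- On either line (1 - Re s)/Re s is at most (1 - σ)/σ, and this constant is at least 1, which
  -- takes care of the imaginary parts. It converts |s|^{-1/2} into |s(1-s)|^{-1/4} at the cost of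
  -- (σ⁻¹ - 1)^{1/4}.
  have hratio : ‖1 - s‖ ≤ (σ⁻¹ - 1) * ‖s‖ := by
    have e : (σ⁻¹ - 1) * ‖s‖ = ‖((σ⁻¹ - 1 : ℝ) : ℂ) * s‖ := by
      rw [norm_mul, Complex.norm_real, Real.norm_of_nonneg hσ1.le]
    have h1 : 1 ≤ σ⁻¹ - 1 := by
      rw [le_sub_iff_add_le, le_inv_comm₀ (by norm_num) hσ0]
      norm_num
      linarith
    have him : s.im ^ 2 ≤ (σ⁻¹ - 1) ^ 2 * s.im ^ 2 :=
      le_mul_of_one_le_left (sq_nonneg _) (one_le_pow₀ h1)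
    have hre : (1 - s.re) ^ 2 ≤ (σ⁻¹ - 1) ^ 2 * s.re ^ 2 := by
      rcases hs with h | h <;> rw [h]
      · rw [← mul_pow, sub_mul, inv_mul_cancel₀ hσ0.ne', one_mul]
      · calc (1 - (1 - σ)) ^ 2 ≤ (1 - σ) ^ 2 := by nlinarith
          _ ≤ _ := le_mul_of_one_le_left (sq_nonneg _) (one_le_pow₀ h1)
    rw [e, ← sq_le_sq₀ (norm_nonneg _) (norm_nonneg _), ← Complex.normSq_eq_norm_sq,
      ← Complex.normSq_eq_norm_sq, Complex.normSq_apply, Complex.normSq_apply]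
    simp only [Complex.sub_re, Complex.one_re, Complex.sub_im, Complex.one_im,
      Complex.re_ofReal_mul, Complex.im_ofReal_mul]
    nlinarith
  set E := 1 / (24 * s.re * (1 / 2 + s.re)) with hE
  have hE2 : 1 / (12 * s.re * (1 / 2 + s.re)) = 2 * E := by rw [hE]; field_simp; norm_num
  rw [hE2] at h
  generalize ‖Complex.Gamma s / Complex.Gamma (s + 1 / 2)‖ = g at *
  rw [norm_mul]
  have e1 : ((‖s‖ * ‖1 - s‖) ^ (-(1 / 4) : ℝ)) ^ 4 = (‖s‖ * ‖1 - s‖)⁻¹ := by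
    rw [← Real.rpow_natCast, ← Real.rpow_mul (by positivity)]
    norm_num
    rw [Real.rpow_neg_one, mul_inv, mul_comm]
  have e2 : ((σ⁻¹ - 1) ^ (1 / 4 : ℝ)) ^ 4 = σ⁻¹ - 1 := by
    rw [← Real.rpow_natCast, ← Real.rpow_mul hσ1.le]
    norm_num
  have e3 : Real.exp (1 / 2 + E) ^ 4 = Real.exp (1 + 2 * E) ^ 2 := by
    rw [← Real.exp_nat_mul, ← Real.exp_nat_mul]
    congr 1
    push_cast
    ring
  refine le_of_pow_le_pow_left₀ (n := 4) (by norm_num) (by positivity) ?_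
  rw [mul_pow, mul_pow, e1, e2, e3, mul_comm (_)⁻¹, ← div_eq_mul_inv, le_div_iff₀ (by positivity)]
  calc g ^ 4 * (‖s‖ * ‖1 - s‖) ≤ g ^ 4 * (‖s‖ * ((σ⁻¹ - 1) * ‖s‖)) := by
        gcongr
    _ = (σ⁻¹ - 1) * (‖s‖ * g ^ 2) ^ 2 := by ring
    _ ≤ (σ⁻¹ - 1) * Real.exp (1 + 2 * E) ^ 2 := by
        have : 0 ≤ ‖s‖ * g ^ 2 := by positivity
        gcongr

theorem norm_connTerm_le_const {σ : ℝ} (hσ0 : 0 < σ) (hσ : σ < 1 / 2) (l : ℕ) {s : ℂ}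
    (hs : s.re = σ ∨ s.re = 1 - σ) {ξ : ℝ} (hξ : 0 < ξ) :
    ‖s * (1 - s)‖ ^ ((2 * (2 * l : ℕ) + 1) / 4 : ℝ) * ‖connTerm (2 * l) s ξ‖ ≤
      max 1 (Real.tan (Real.pi * σ)) * (σ⁻¹ - 1) ^ (1 / 4 : ℝ) *
        Real.exp (1 / 2 + 1 / (24 * s.re * (1 / 2 + s.re))) *
        (Real.exp (((2 * l : ℕ) - s.re) * ξ) *
          ∑' n, absBinomCoeff (2 * l) n * Real.exp (-2 * ξ) ^ n) := by
  have hre0 : 0 < s.re := by rcases hs with h | h <;> rw [h] <;> linarith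
  have hre1 : s.re < 1 := by rcases hs with h | h <;> rw [h] <;> linarith
  have h1 := norm_connTerm_le l hre0 hre1 hξ
  have h2 := norm_Gamma_half_sub_div_le hσ0 hσ hs
  have h3 := norm_Gamma_div_Gamma_le hσ0 hσ hs
  have hp : 0 < ‖s‖ := hre0.trans_le (Complex.re_le_norm s)
  have hq : 0 < ‖1 - s‖ := lt_of_lt_of_le (by simpa using hre1) (Complex.re_le_norm (1 - s))
  have hN : 0 < ‖s * (1 - s)‖ := by rw [norm_mul]; positivity
  generalize ‖s * (1 - s)‖ = N at *
  have e : N ^ ((2 * (2 * l : ℕ) + 1) / 4 : ℝ) = N ^ l * N ^ (1 / 4 : ℝ) := by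
    rw [← Real.rpow_natCast, ← Real.rpow_add hN]
    congr 1
    push_cast
    ring
  have e2 : N ^ (1 / 4 : ℝ) * N ^ (-(1 / 4) : ℝ) = 1 := by
    rw [← Real.rpow_add hN]
    norm_num
  have hD : 0 ≤ ∑' n, absBinomCoeff (2 * l) n * Real.exp (-2 * ξ) ^ n :=
    tsum_nonneg fun n => by rw [absBinomCoeff]; positivity
  have hT : 0 ≤ max 1 (Real.tan (Real.pi * σ)) := zero_le_one.trans (le_max_left _ _)
  rw [e]
  generalize ∑' n, absBinomCoeff (2 * l) n * Real.exp (-2 * ξ) ^ n = D at *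
  generalize max 1 (Real.tan (Real.pi * σ)) = T at *
  generalize (σ⁻¹ - 1) ^ (1 / 4 : ℝ) = c at *
  generalize Real.exp (1 / 2 + 1 / (24 * s.re * (1 / 2 + s.re))) = X at *
  have hY := Real.exp_pos (((2 * l : ℕ) - s.re) * ξ)
  generalize Real.exp (((2 * l : ℕ) - s.re) * ξ) = Y at *
  calc N ^ l * N ^ (1 / 4 : ℝ) * ‖connTerm (2 * l) s ξ‖ =
      N ^ (1 / 4 : ℝ) * (‖connTerm (2 * l) s ξ‖ * N ^ l) := by ring
    _ ≤ N ^ (1 / 4 : ℝ) * (T * (N ^ (-(1 / 4) : ℝ) * (c * X)) * (Y * D)) := by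
        have := h2.trans (mul_le_mul_of_nonneg_left h3 hT)
        exact mul_le_mul_of_nonneg_left
          (h1.trans (mul_le_mul_of_nonneg_right this (by positivity))) (by positivity)
    _ = (N ^ (1 / 4 : ℝ) * N ^ (-(1 / 4) : ℝ)) * (T * c * X * (Y * D)) := by ring
    _ = _ := by rw [e2, one_mul]

/-- The bound on the boundary lines of the strip. -/
theorem norm_mul_legendreP_le_of_re {σ : ℝ} (hσ0 : 0 < σ) (hσ : σ < 1 / 2) (l : ℕ) {s : ℂ}
    (hs : s.re = σ ∨ s.re = 1 - σ) {ξ : ℝ} (hξ : 0 < ξ) :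
    ‖s * (1 - s)‖ ^ ((2 * (2 * l : ℕ) + 1) / 4 : ℝ) *
        ‖legendreP (-((2 * l : ℕ) : ℂ)) (s - 1) (Real.cosh ξ)‖ ≤
      (√Real.pi)⁻¹ * ((2 * Real.sinh ξ) ^ (2 * l))⁻¹ *
        (boundConst σ * Real.exp (((2 * l : ℕ) - σ) * ξ) +
          boundConst' σ * Real.exp (((2 * l : ℕ) - (1 - σ)) * ξ)) *
          ∑' n, absBinomCoeff (2 * l) n * Real.exp (-2 * ξ) ^ n := by
  have hre0 : 0 < s.re := by rcases hs with h | h <;> rw [h] <;> linarith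
  have hre1 : s.re < 1 := by rcases hs with h | h <;> rw [h] <;> linarith
  have hre2 : s.re ≠ 1 / 2 := by
    rcases hs with h | h <;> rw [h]
    · exact hσ.ne
    · intro h'; linarith
  have hs' : (1 - s).re = σ ∨ (1 - s).re = 1 - σ := by
    rcases hs with h | h
    · right; simp [h]
    · left; simp [h]
  have b1 := norm_connTerm_le_const hσ0 hσ l hs hξ
  have b2 := norm_connTerm_le_const hσ0 hσ l hs' hξ
  rw [show (1 - s) * (1 - (1 - s)) = s * (1 - s) by ring] at b2
  have hS : 0 < Real.sinh ξ := Real.sinh_pos_iff.2 hξ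
  have hnorm : ‖legendreP (-((2 * l : ℕ) : ℂ)) (s - 1) (Real.cosh ξ)‖ ≤
      (√Real.pi)⁻¹ * ((2 * Real.sinh ξ) ^ (2 * l))⁻¹ *
        (‖connTerm (2 * l) s ξ‖ + ‖connTerm (2 * l) (1 - s) ξ‖) := by
    rw [legendreP_cosh_eq hre0 hre1 hre2 hξ, norm_mul, norm_mul, norm_inv, norm_inv, norm_pow,
      norm_mul, ← Complex.ofReal_sinh, Complex.norm_real, Complex.norm_real,
      Real.norm_of_nonneg (Real.sqrt_nonneg _), Real.norm_of_nonneg hS.le, Complex.norm_ofNat]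
    gcongr
    exact norm_add_le _ _
  have e1 : (1 : ℝ) / 2 + (1 - σ) = 3 / 2 - σ := by ring
  have hsum : ‖s * (1 - s)‖ ^ ((2 * (2 * l : ℕ) + 1) / 4 : ℝ) *
      (‖connTerm (2 * l) s ξ‖ + ‖connTerm (2 * l) (1 - s) ξ‖) ≤
      (boundConst σ * Real.exp (((2 * l : ℕ) - σ) * ξ) +
          boundConst' σ * Real.exp (((2 * l : ℕ) - (1 - σ)) * ξ)) *
          ∑' n, absBinomCoeff (2 * l) n * Real.exp (-2 * ξ) ^ n := by
    rw [boundConst, boundConst', ← e1, mul_add]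
    refine (add_le_add b1 b2).trans (le_of_eq ?_)
    -- Passing from one line to the other exchanges the two terms, so both lines give the same sum:
    -- C_σ goes with the term of real part σ, C'_σ with that of real part 1 - σ.
    rcases hs with h | h
    · rw [show (1 - s).re = 1 - σ by simp [h], h]
      ring
    · rw [show (1 - s).re = σ by simp [h], h]
      ring
  calc _ ≤ ‖s * (1 - s)‖ ^ ((2 * (2 * l : ℕ) + 1) / 4 : ℝ) *
      ((√Real.pi)⁻¹ * ((2 * Real.sinh ξ) ^ (2 * l))⁻¹ *
        (‖connTerm (2 * l) s ξ‖ + ‖connTerm (2 * l) (1 - s) ξ‖)) := by gcongr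
    _ = (√Real.pi)⁻¹ * ((2 * Real.sinh ξ) ^ (2 * l))⁻¹ *
        (‖s * (1 - s)‖ ^ ((2 * (2 * l : ℕ) + 1) / 4 : ℝ) *
      (‖connTerm (2 * l) s ξ‖ + ‖connTerm (2 * l) (1 - s) ξ‖)) := by ring
    _ ≤ _ := by
      rw [mul_assoc _ (_ + _)]
      gcongr

/-! ### Holomorphy and growth in s, and the Phragmén–Lindelöf principle -/

theorem factorial_le_norm_ascPochhammer (m n : ℕ) :
    (n.factorial : ℝ) ≤ ‖(ascPochhammer ℂ n).eval (m + 1 : ℂ)‖ := by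
  have h := norm_ascPochhammer_le_of_re (s := 1) (t := m + 1) (by simp) (by simp) (by simp) n
  rw [ascPochhammer_eval_one, Complex.norm_natCast] at h
  exact h

/-- The terms of the binomial series of `(1 - q)^(-R)`. -/
noncomputable def binomTerm (R q : ℝ) (n : ℕ) : ℝ :=
  (ascPochhammer ℝ n).eval R / (n.factorial : ℝ) * q ^ n

theorem hasSum_binomTerm (R : ℝ) {q : ℝ} (hq0 : 0 ≤ q) (hq : q < 1) :
    HasSum (binomTerm R q) ((1 - q) ^ (-R)) :=
  hasSum_ascPochhammer_mul_pow_real R hq0 hq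

theorem binomTerm_nonneg {R q : ℝ} (hR : 0 ≤ R) (hq0 : 0 ≤ q) (n : ℕ) : 0 ≤ binomTerm R q n := by
  have h := (norm_nonneg _).trans (norm_ascPochhammer_eval_le n (α := (R : ℂ)) (r := R)
    (by rw [Complex.norm_real, Real.norm_of_nonneg hR]))
  rw [binomTerm]
  positivity

/-- As |(m+1)_n| ≥ n!, the term at q² is at most the square of the binomial term (R)_n q^n / n!, and
one of the two factors is bounded by the full sum (1 - q)^{-R}. The majorant depends on a and b only
through R: this gives both holomorphy in s and exponential growth. -/
theorem norm_hypCoeff_mul_pow_le (m : ℕ) {a b : ℂ} {R q : ℝ} (ha : ‖a‖ ≤ R) (hb : ‖b‖ ≤ R)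
    (hq0 : 0 ≤ q) (hq : q < 1) (n : ℕ) :
    ‖hypCoeff a b (m + 1) n * ((q ^ 2 : ℝ) : ℂ) ^ n‖ ≤ (1 - q) ^ (-R) * binomTerm R q n := by
  have hR : 0 ≤ R := (norm_nonneg a).trans ha
  have h1 := norm_ascPochhammer_eval_le n ha
  have h2 := norm_ascPochhammer_eval_le n hb
  have h3 := factorial_le_norm_ascPochhammer m n
  have h0 := binomTerm_nonneg hR hq0 n
  have h4 : binomTerm R q n ≤ (1 - q) ^ (-R) :=
    le_hasSum (hasSum_binomTerm R hq0 hq) n fun k _ => binomTerm_nonneg hR hq0 k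
  have hnf : (0 : ℝ) < n.factorial := by exact_mod_cast n.factorial_pos
  have hP : 0 ≤ (ascPochhammer ℝ n).eval R := (norm_nonneg _).trans h1
  refine le_trans ?_ (mul_le_mul_of_nonneg_right h4 h0)
  rw [hypCoeff, ordinaryHypergeometricCoefficient, norm_mul, norm_mul, norm_mul, norm_mul,
    norm_inv, norm_inv, norm_pow, Complex.norm_natCast, Complex.norm_real,
    Real.norm_of_nonneg (by positivity), binomTerm]
  calc (n.factorial : ℝ)⁻¹ * ‖(ascPochhammer ℂ n).eval a‖ * ‖(ascPochhammer ℂ n).eval b‖ *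
      ‖(ascPochhammer ℂ n).eval (m + 1 : ℂ)‖⁻¹ * (q ^ 2) ^ n ≤
      (n.factorial : ℝ)⁻¹ * (ascPochhammer ℝ n).eval R * (ascPochhammer ℝ n).eval R *
      (n.factorial : ℝ)⁻¹ * (q ^ 2) ^ n := by gcongr
    _ = _ := by rw [← pow_mul, mul_comm 2 n, pow_mul]; ring

theorem norm_ordinaryHypergeometric_le (m : ℕ) {a b : ℂ} {R q : ℝ} (ha : ‖a‖ ≤ R) (hb : ‖b‖ ≤ R)
    (hq0 : 0 ≤ q) (hq : q < 1) :
    ‖₂F₁ a b (m + 1 : ℂ) ((q ^ 2 : ℝ) : ℂ)‖ ≤ (1 - q) ^ (-R) * (1 - q) ^ (-R) := by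
  rw [ordinaryHypergeometric_eq_tsum_hypCoeff]
  exact tsum_of_norm_bounded ((hasSum_binomTerm R hq0 hq).mul_left _)
    (norm_hypCoeff_mul_pow_le m ha hb hq0 hq)

theorem differentiable_ascPochhammer_eval (n : ℕ) {f : ℂ → ℂ} (hf : Differentiable ℂ f) :
    Differentiable ℂ fun s => (ascPochhammer ℂ n).eval (f s) :=
  (ascPochhammer ℂ n).differentiable.comp hf

theorem differentiable_ordinaryHypergeometric (m : ℕ) {q : ℝ} (hq0 : 0 ≤ q) (hq : q < 1) :
    Differentiable ℂ fun s : ℂ => ₂F₁ (m + 1 - s) (1 - s) (m + 1 : ℂ) ((q ^ 2 : ℝ) : ℂ) := by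
  intro s
  set R : ℝ := ‖s‖ + m + 2 with hR
  have hb : ∀ w ∈ Metric.ball (0 : ℂ) (‖s‖ + 1), ‖(m + 1 - w : ℂ)‖ ≤ R ∧ ‖1 - w‖ ≤ R := by
    intro w hw
    have hw' := (mem_ball_zero_iff.1 hw).le
    have hm : (0 : ℝ) ≤ m := m.cast_nonneg
    have e : ‖(m + 1 : ℂ)‖ = m + 1 := by exact_mod_cast Complex.norm_natCast (m + 1)
    constructor
    · refine (norm_sub_le _ _).trans ?_
      rw [e]
      linarith
    · refine (norm_sub_le _ _).trans ?_
      rw [norm_one]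
      linarith
  have h := Complex.differentiableOn_tsum_of_summable_norm
    (F := fun n (w : ℂ) => hypCoeff (m + 1 - w) (1 - w) (m + 1) n * ((q ^ 2 : ℝ) : ℂ) ^ n)
    (U := Metric.ball 0 (‖s‖ + 1)) ((hasSum_binomTerm R hq0 hq).summable.mul_left ((1 - q) ^ (-R)))
    (fun n => Differentiable.differentiableOn ?_) Metric.isOpen_ball
    (fun n w hw => norm_hypCoeff_mul_pow_le m (hb w hw).1 (hb w hw).2 hq0 hq n)
  · simp only [ordinaryHypergeometric_eq_tsum_hypCoeff]
    exact h.differentiableAt (Metric.isOpen_ball.mem_nhds (mem_ball_zero_iff.2 (by linarith)))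
  · have d1 := differentiable_ascPochhammer_eval n (f := fun w => (m + 1 - w : ℂ)) (by fun_prop)
    have d2 := differentiable_ascPochhammer_eval n (f := fun w => (1 - w : ℂ)) (by fun_prop)
    simp only [hypCoeff, ordinaryHypergeometricCoefficient]
    fun_prop

theorem exists_sq_eq_div {u : ℝ} (hu : 1 < u) :
    ∃ q : ℝ, 0 ≤ q ∧ q < 1 ∧ ((u : ℂ) - 1) / (u + 1) = ((q ^ 2 : ℝ) : ℂ) := by
  have h0 : 0 ≤ (u - 1) / (u + 1) := div_nonneg (by linarith) (by linarith)
  refine ⟨√((u - 1) / (u + 1)), Real.sqrt_nonneg _, ?_, ?_⟩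
  · rw [Real.sqrt_lt' one_pos, one_pow, div_lt_one (by linarith)]
    linarith
  · rw [Real.sq_sqrt h0]
    push_cast
    rfl

theorem differentiable_legendreP (m : ℕ) {ξ : ℝ} (hξ : 0 < ξ) :
    Differentiable ℂ fun s : ℂ => legendreP (-(m : ℂ)) (s - 1) (Real.cosh ξ) := by
  obtain ⟨q, hq0, hq, hw⟩ := exists_sq_eq_div (Real.one_lt_cosh.2 hξ.ne')
  simp only [legendreP_cosh_eq_regSol m _ hξ, regSol, ← Complex.ofReal_cosh, hw]
  have hb : (1 + (Real.cosh ξ : ℂ)) / 2 ≠ 0 := by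
    have := Real.cosh_pos ξ
    exact_mod_cast (by positivity : (1 + Real.cosh ξ) / 2 ≠ 0)
  refine (differentiable_const _).mul (Differentiable.mul ?_
    (differentiable_ordinaryHypergeometric m hq0 hq))
  exact Differentiable.const_cpow (by fun_prop) (Or.inl hb)

/-- Exponential growth of the Legendre function in its degree. -/
theorem exists_norm_legendreP_le (m : ℕ) {ξ : ℝ} (hξ : 0 < ξ) :
    ∃ K c : ℝ, 0 ≤ K ∧ 0 ≤ c ∧ ∀ s : ℂ, 0 < s.re → s.re < 1 →
      ‖legendreP (-(m : ℂ)) (s - 1) (Real.cosh ξ)‖ ≤ K * Real.exp (c * (1 + |s.im|)) := by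
  obtain ⟨q, hq0, hq, hw⟩ := exists_sq_eq_div (Real.one_lt_cosh.2 hξ.ne')
  have hlog : 0 ≤ -Real.log (1 - q) := by
    have := Real.log_nonpos (by linarith : 0 ≤ 1 - q) (by linarith)
    linarith
  have hm : (0 : ℝ) ≤ m := m.cast_nonneg
  refine ⟨‖(m.factorial : ℂ)⁻¹ * (Complex.sinh ξ / 2) ^ m‖, 2 * (-Real.log (1 - q)) * (m + 2),
    norm_nonneg _, by positivity, fun s h0 h1 => ?_⟩
  rw [legendreP_cosh_eq_regSol m s hξ, norm_mul]
  refine mul_le_mul_of_nonneg_left ?_ (norm_nonneg _)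
  rw [regSol, ← Complex.ofReal_cosh, hw, norm_mul]
  have hs : ‖s‖ ≤ 1 + |s.im| := by
    refine (Complex.norm_le_abs_re_add_abs_im s).trans ?_
    rw [abs_of_pos h0]
    linarith
  have e : ‖(m + 1 : ℂ)‖ = m + 1 := by exact_mod_cast Complex.norm_natCast (m + 1)
  set R : ℝ := (m + 2) * (1 + |s.im|) with hR
  have hi := abs_nonneg s.im
  have ha : ‖(m + 1 - s : ℂ)‖ ≤ R := by
    refine (norm_sub_le _ _).trans ?_
    rw [e]
    nlinarith
  have hb : ‖1 - s‖ ≤ R := by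
    refine (norm_sub_le _ _).trans ?_
    rw [norm_one]
    nlinarith
  have hF := norm_ordinaryHypergeometric_le m ha hb hq0 hq
  have hC : 1 ≤ (1 + Real.cosh ξ) / 2 := by
    have := Real.one_le_cosh ξ
    linarith
  have hpow : ‖((1 + (Real.cosh ξ : ℂ)) / 2) ^ (-(m + 1 - s))‖ ≤ 1 := by
    rw [show (1 + (Real.cosh ξ : ℂ)) / 2 = (((1 + Real.cosh ξ) / 2 : ℝ) : ℂ) by push_cast; ring,
      Complex.norm_cpow_eq_rpow_re_of_pos (by linarith)]
    refine Real.rpow_le_one_of_one_le_of_nonpos hC ?_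
    simp
    linarith
  calc _ ≤ 1 * ((1 - q) ^ (-R) * (1 - q) ^ (-R)) :=
        mul_le_mul hpow hF (norm_nonneg _) zero_le_one
    _ = _ := by
      rw [one_mul, Real.rpow_def_of_pos (by linarith), ← Real.exp_add]
      congr 1
      rw [hR]
      ring

theorem norm_mul_one_sub_le {s : ℂ} (h0 : 0 < s.re) (h1 : s.re < 1) :
    ‖s * (1 - s)‖ ≤ Real.exp (2 * (1 + |s.im|)) := by
  have hs : ‖s‖ ≤ 1 + |s.im| := by
    refine (Complex.norm_le_abs_re_add_abs_im s).trans ?_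
    rw [abs_of_pos h0]
    linarith
  have h2 : ‖1 - s‖ ≤ 1 + |s.im| := by
    refine (Complex.norm_le_abs_re_add_abs_im _).trans ?_
    simp only [Complex.sub_re, Complex.one_re, Complex.sub_im, Complex.one_im, zero_sub, abs_neg]
    rw [abs_of_pos (by linarith)]
    linarith
  have h3 : 1 + |s.im| ≤ Real.exp (1 + |s.im|) := by
    linarith [Real.add_one_le_exp (1 + |s.im|)]
  rw [norm_mul, two_mul, Real.exp_add]
  exact mul_le_mul (hs.trans h3) (h2.trans h3) (norm_nonneg _) (Real.exp_pos _).le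

/-- The Phragmén–Lindelöf step: the bound on the boundary lines holds in the strip. -/
theorem norm_mul_legendreP_le {σ : ℝ} (hσ0 : 0 < σ) (hσ : σ < 1 / 2) (m : ℕ) {p M : ℝ}
    (hp : 0 ≤ p) {ξ : ℝ} (hξ : 0 < ξ)
    (hM : ∀ s : ℂ, s.re = σ ∨ s.re = 1 - σ →
      ‖s * (1 - s)‖ ^ p * ‖legendreP (-(m : ℂ)) (s - 1) (Real.cosh ξ)‖ ≤ M)
    {s : ℂ} (hs : s ∈ strip σ) :
    ‖s * (1 - s)‖ ^ p * ‖legendreP (-(m : ℂ)) (s - 1) (Real.cosh ξ)‖ ≤ M := by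
  set f : ℂ → ℂ := fun s =>
    (s * (1 - s)) ^ (p : ℂ) * legendreP (-(m : ℂ)) (s - 1) (Real.cosh ξ) with hf
  have hnorm : ∀ s, ‖f s‖ = ‖s * (1 - s)‖ ^ p *
      ‖legendreP (-(m : ℂ)) (s - 1) (Real.cosh ξ)‖ := fun s => by
    rw [hf, norm_mul, Complex.norm_cpow_real]
  have hcl : closure (Complex.re ⁻¹' Ioo σ (1 - σ)) ⊆ Complex.re ⁻¹' Icc σ (1 - σ) :=
    closure_minimal (preimage_mono Ioo_subset_Icc_self) (isClosed_Icc.preimage Complex.continuous_re)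
  have hd : DiffContOnCl ℂ f (Complex.re ⁻¹' Ioo σ (1 - σ)) := by
    refine DifferentiableOn.diffContOnCl fun z hz => ?_
    have hz' := hcl hz
    have hz1 : σ ≤ z.re := hz'.1
    have hz2 : z.re ≤ 1 - σ := hz'.2
    -- With z = x + iy the real part is x(1 - x) + y² > 0, so the principal power is holomorphic on
    -- the closed strip.
    have hslit : z * (1 - z) ∈ Complex.slitPlane := by
      refine Or.inl ?_
      simp
      nlinarith [sq_nonneg z.im]
    refine DifferentiableAt.differentiableWithinAt ?_
    refine DifferentiableAt.mul ?_ (differentiable_legendreP m hξ z)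
    exact DifferentiableAt.cpow (by fun_prop) (by fun_prop) hslit
  rw [← hnorm]
  refine PhragmenLindelof.vertical_strip hd ⟨1, ?_, ?_⟩ (fun z hz => ?_) (fun z hz => ?_) hs.1 hs.2
  · rw [lt_div_iff₀ (by linarith)]
    linarith [Real.pi_gt_three]
  · obtain ⟨K, c, hK, hc, hle⟩ := exists_norm_legendreP_le m hξ
    refine ⟨2 * p + c, Asymptotics.IsBigO.of_bound K ?_⟩
    refine Filter.mem_inf_of_right (mem_principal.2 fun z hz => ?_)
    have hz' : σ < z.re ∧ z.re < 1 - σ := hz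
    have h0 : 0 < z.re := by linarith [hz'.1]
    have h1 : z.re < 1 := by linarith [hz'.2]
    have b1 := hle z h0 h1
    have b2 := Real.rpow_le_rpow (norm_nonneg _) (norm_mul_one_sub_le h0 h1) hp
    have b3 : 1 + |z.im| ≤ Real.exp (1 * |z.im|) := by
      rw [one_mul, add_comm]
      exact Real.add_one_le_exp _
    rw [← Real.exp_mul] at b2
    rw [Set.mem_ofPred_eq]
    rw [hnorm, Real.norm_of_nonneg (Real.exp_pos _).le]
    calc _ ≤ Real.exp (2 * (1 + |z.im|) * p) * (K * Real.exp (c * (1 + |z.im|))) :=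
          mul_le_mul b2 b1 (norm_nonneg _) (Real.exp_pos _).le
      _ = K * Real.exp ((2 * p + c) * (1 + |z.im|)) := by
          rw [mul_left_comm, ← Real.exp_add]
          ring_nf
      _ ≤ _ := by gcongr
  · rw [hnorm]; exact hM z (Or.inl hz)
  · rw [hnorm]; exact hM z (Or.inr hz)

/-! ### The variable u = cosh ξ, and the case m = 2 -/

theorem xOf_cosh {ξ : ℝ} (hξ : 0 < ξ) : xOf (Real.cosh ξ) = Real.exp ξ := by
  rw [xOf, Real.cosh_sq, add_sub_cancel_right, Real.sqrt_sq (Real.sinh_pos_iff.2 hξ).le,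
    Real.cosh_add_sinh]

theorem exists_cosh_eq {u : ℝ} (hu : 1 < u) : ∃ ξ : ℝ, 0 < ξ ∧ Real.cosh ξ = u := by
  have hr : 0 < √(u ^ 2 - 1) := Real.sqrt_pos.2 (by nlinarith)
  have hsq : √(u ^ 2 - 1) ^ 2 = u ^ 2 - 1 := Real.sq_sqrt (by nlinarith)
  refine ⟨Real.log (u + √(u ^ 2 - 1)), Real.log_pos (by linarith), ?_⟩
  rw [Real.cosh_log (by linarith)]
  have h : u + √(u ^ 2 - 1) ≠ 0 := by linarith
  field_simp
  linear_combination hsq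

theorem absBinomCoeff_mul_rpow (m n : ℕ) (ξ : ℝ) :
    |(ascPochhammer ℝ n).eval (1 / 2 - (m : ℝ))| / (n.factorial : ℝ) *
      Real.exp ξ ^ (-2 * (n : ℝ)) = absBinomCoeff m n * Real.exp (-2 * ξ) ^ n := by
  rw [absBinomCoeff, ← Real.exp_mul, ← Real.exp_nat_mul]
  congr 2
  ring

theorem norm_legendreP_le_of_even {σ : ℝ} (hσ0 : 0 < σ) (hσ : σ < 1 / 2) {m : ℕ} (hm : Even m)
    {s : ℂ} (hs : s ∈ strip σ) {ξ : ℝ} (hξ : 0 < ξ) :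
    ‖legendreP (-(m : ℂ)) (s - 1) (Real.cosh ξ)‖ ≤
      ‖s * (1 - s)‖ ^ (-(2 * (m : ℝ) + 1) / 4) *
        ((boundConst σ * Real.exp ξ ^ ((m : ℝ) - σ) +
            boundConst' σ * Real.exp ξ ^ ((m : ℝ) - 1 + σ)) /
          (√Real.pi * (4 * (Real.cosh ξ ^ 2 - 1)) ^ ((m : ℝ) / 2))) *
        ∑' n : ℕ, absBinomCoeff m n * Real.exp (-2 * ξ) ^ n := by
  obtain ⟨l, hl⟩ := hm.exists_two_nsmul
  obtain rfl : m = 2 * l := by simpa using hl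
  have h := norm_mul_legendreP_le hσ0 hσ (2 * l) (p := (2 * (2 * l : ℕ) + 1) / 4) (by positivity) hξ
    (fun z hz => norm_mul_legendreP_le_of_re hσ0 hσ l hz hξ) hs
  have hre0 : 0 < s.re := hσ0.trans_le hs.1
  have hre1 : s.re < 1 := by linarith [hs.2]
  have hp : 0 < ‖s‖ := hre0.trans_le (Complex.re_le_norm s)
  have hq : 0 < ‖1 - s‖ := lt_of_lt_of_le (by simpa using hre1) (Complex.re_le_norm (1 - s))
  have hN : 0 < ‖s * (1 - s)‖ := by rw [norm_mul]; positivity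
  have hS : 0 < Real.sinh ξ := Real.sinh_pos_iff.2 hξ
  have e1 : (4 * (Real.cosh ξ ^ 2 - 1)) ^ (((2 * l : ℕ) : ℝ) / 2) =
      (2 * Real.sinh ξ) ^ (2 * l) := by
    rw [Real.cosh_sq, add_sub_cancel_right, show 4 * Real.sinh ξ ^ 2 = (2 * Real.sinh ξ) ^ 2 by ring,
      show ((2 * l : ℕ) : ℝ) / 2 = l by push_cast; ring, Real.rpow_natCast, ← pow_mul]
  have e2 : Real.exp ξ ^ (((2 * l : ℕ) : ℝ) - σ) = Real.exp (((2 * l : ℕ) - σ) * ξ) := by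
    rw [← Real.exp_mul]; ring_nf
  have e3 : Real.exp ξ ^ (((2 * l : ℕ) : ℝ) - 1 + σ) = Real.exp (((2 * l : ℕ) - (1 - σ)) * ξ) := by
    rw [← Real.exp_mul]; ring_nf
  rw [e1, e2, e3, neg_div, Real.rpow_neg hN.le, mul_assoc, le_inv_mul_iff₀ (by positivity)]
  refine h.trans (le_of_eq ?_)
  rw [div_eq_mul_inv, mul_inv]
  ring

/-- Among the (-3/2)_n only the one with n = 1 is negative, so taking absolute values adds 2 · (3/2)
r to the binomial series of (1 - r)^{3/2}. -/
theorem tsum_absBinomCoeff_two {r : ℝ} (hr0 : 0 ≤ r) (hr : r < 1) :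
    ∑' n, absBinomCoeff 2 n * r ^ n = (1 - r) ^ (3 / 2 : ℝ) + 3 * r := by
  have h := hasSum_ascPochhammer_mul_pow_real (-3 / 2) hr0 hr
  have h2 : HasSum (fun n => if n = 1 then 3 * r else 0) (3 * r) := hasSum_ite_eq 1 (3 * r)
  have h3 := h.add h2
  rw [show -(-3 / 2 : ℝ) = 3 / 2 by norm_num] at h3
  rw [← h3.tsum_eq]
  refine tsum_congr fun n => ?_
  have hpos : ∀ k : ℕ, 0 ≤ (ascPochhammer ℝ (k + 2)).eval (-3 / 2) := by
    intro k
    induction k with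
    | zero =>
      rw [ascPochhammer_succ_eval, ascPochhammer_succ_eval]
      norm_num
    | succ k ih =>
      rw [ascPochhammer_succ_eval]
      refine mul_nonneg ih ?_
      have : (0 : ℝ) ≤ k := k.cast_nonneg
      push_cast
      linarith
  rw [absBinomCoeff, show (1 / 2 - ((2 : ℕ) : ℝ)) = -3 / 2 by norm_num]
  rcases n with _ | _ | n
  · simp
  · simp
    rw [abs_of_neg (by norm_num)]
    ring
  · rw [abs_of_nonneg (hpos n)]
    simp

end LegendreBound

theorem mainTheorem8 (σ : ℝ) (hσ0 : 0 < σ) (hσ : σ < 1 / 2) :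
    (∀ m : ℕ, Even m → ∀ s ∈ LegendreBound.strip σ, ∀ u : ℝ, 1 < u →
      (Summable fun n : ℕ =>
        |(ascPochhammer ℝ n).eval (1 / 2 - (m : ℝ))| / (n.factorial : ℝ) *
          LegendreBound.xOf u ^ (-2 * (n : ℝ))) ∧
      ‖LegendreBound.legendreP (-(m : ℂ)) (s - 1) u‖ ≤
        ‖s * (1 - s)‖ ^ (-(2 * (m : ℝ) + 1) / 4) *
          ((LegendreBound.boundConst σ * LegendreBound.xOf u ^ ((m : ℝ) - σ) +
              LegendreBound.boundConst' σ * LegendreBound.xOf u ^ ((m : ℝ) - 1 + σ)) /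
            (√Real.pi * (4 * (u ^ 2 - 1)) ^ ((m : ℝ) / 2))) *
          ∑' n : ℕ, |(ascPochhammer ℝ n).eval (1 / 2 - (m : ℝ))| / (n.factorial : ℝ) *
            LegendreBound.xOf u ^ (-2 * (n : ℝ))) ∧
    (∀ s ∈ LegendreBound.strip σ, ∀ u : ℝ, 1 < u →
      ‖LegendreBound.legendreP (-2) (s - 1) u‖ ≤
        ‖s * (1 - s)‖ ^ (-(5 / 4) : ℝ) * (LegendreBound.pSigma σ u / (u ^ 2 - 1))) := by
  have hexp : ∀ ξ : ℝ, 0 < ξ → Real.exp (-2 * ξ) < 1 := fun ξ hξ => by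
    rw [Real.exp_lt_one_iff]; linarith
  constructor
  · intro m hm s hs u hu
    obtain ⟨ξ, hξ, rfl⟩ := LegendreBound.exists_cosh_eq hu
    rw [LegendreBound.xOf_cosh hξ]
    simp only [LegendreBound.absBinomCoeff_mul_rpow]
    exact ⟨LegendreBound.summable_absBinomCoeff m (Real.exp_pos _).le (hexp ξ hξ),
      LegendreBound.norm_legendreP_le_of_even hσ0 hσ hm hs hξ⟩
  · intro s hs u hu
    obtain ⟨ξ, hξ, rfl⟩ := LegendreBound.exists_cosh_eq hu
    have h := LegendreBound.norm_legendreP_le_of_even hσ0 hσ even_two hs hξ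
    have hx : Real.exp ξ ^ (-2 : ℝ) = Real.exp (-2 * ξ) := by
      rw [← Real.exp_mul, mul_comm]
    rw [LegendreBound.tsum_absBinomCoeff_two (Real.exp_pos _).le (hexp ξ hξ)] at h
    rw [LegendreBound.pSigma, LegendreBound.xOf_cosh hξ, hx]
    have e1 : (-(2 * ((2 : ℕ) : ℝ) + 1) / 4) = (-(5 / 4) : ℝ) := by norm_num
    have e2 : (((2 : ℕ) : ℝ) / 2) = 1 := by norm_num
    have e3 : (((2 : ℕ) : ℝ) - 1 + σ) = 1 + σ := by push_cast; ring
    rw [e1, e2, e3, Real.rpow_one] at h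
    push_cast at h
    refine h.trans (le_of_eq ?_)
    have hS : Real.cosh ξ ^ 2 - 1 ≠ 0 := by
      rw [Real.cosh_sq, add_sub_cancel_right]
      exact pow_ne_zero 2 (Real.sinh_pos_iff.2 hξ).ne'
    have hpi : √Real.pi ≠ 0 := (Real.sqrt_pos.2 Real.pi_pos).ne'
    field_simp
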